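/- **Setting.** Let $f:\mathbb N\to[0,\infty)$ with $f(0)=0$ and $f(i)>0$ for $i\ge1$. A generalized attachment model $\mathrm{GAM}(f,\{s_n\})$ is built from variables $b_n\in\{0,1\}$, $t(n)\in\{1,2,\dots\}$ ($n\ge1$), adapted to a filtration $(\mathcal F_n)_{n\ge0}$, and a (possibly random) sequence $s_n\in[0,1]$, with $s_n$ measurable with respect to $\mathcal F_{n-1}$, as follows. At time $1$ there is one group (group $1$), of cardinality $A_1(1)=1$, and $A_j(1)=0$ for $j\ge2$. If $L_n$ groups exist at time $n$, with cardinalities $A_1(n),\dots,A_{L_n}(n)$, then, conditionally on $\mathcal F_{n-1}$, the variables $b_n$ and $t(n)$ are independent, $b_n$ is Bernoulli with mean $s_n$, and $t(n)=k$ with probability $f(A_k(n))/\sum_{j=1}^{L_n}f(A_j(n))$. If $b_n=1$, a new group with label $L_n+1$ and cardinality $1$ is created and all other cardinalities stay unchanged; if $b_n=0$, the cardinality of group $t(n)$ increases by $1$ and nothing else changes. The genealogical tree $\mathcal G$ has root $1$, and the parent of a group created at step $n$ (that is, with $b_n=1$) is the group $t(n)$. $G_n$ is the set of the groups whose distance from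 the root in $\mathcal G$ is at least $n$. $\mathrm{Lead}$ denotes the leading group, the one whose cardinality tends to infinity; $\{\mathrm{Lead}\in G_n\}$ is the event that a group of $G_n$ has cardinality tending to infinity. **Theorem 1.7.** Suppose that $s_n\le p$ for all $n\ge1$, where $p<1$. For $k\ge0$ let $$\theta_k=\Bigl(\sum_{s=k+1}^\infty\frac{2}{(1-p)^2f(s)^2}\Bigr)^{-1/2},\qquad w_k=\prod_{s=1}^k\frac1{1+\theta_k/(f(s)(1-p))},$$ and suppose that $\sum_{n\ge1}1/f(n)<\infty$ and $\sum_{k\ge1}w_k<\infty$. Put $$m=\frac4{1-p}\sum_{k=0}^\infty w_k,\qquad \Phi(x)=\frac4{1-p}\sum_{k=0}^\infty w_k\,\frac{f(1)(1-p)+\theta_k}{f(1)(1-p)+\theta_k+x},\qquad a=\inf_{k\ge1}f(k),$$ $$C_1=\exp\Bigl(a\sum_{k=1}^\infty\frac1{f(k)}\Bigr),\qquad C_2=\frac{(1-p)\,a}2,\qquad c_n(r,M)=c_n(M)=\log\frac{m}{\Phi(n/M)}-1 .$$ Then $m,C_1,C_2>0$; for all $r,M\ge1$, $c_n(r,M)\to\infty$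 as $n\to\infty$; and for every $n\ge0$ $$\mathbb P(\mathrm{Lead}\in G_n)\le\inf_{r,M\ge1}\Bigl[m^n e^{-c_n(r,M)\,n}+r^{-n}+C_1e^{-MC_2}\Bigr].$$ In particular the constants $m,C_1,C_2$ and the functions $c_n(r,M)$ are explicit and depend only on $f$ and $p$ (and $c_n$ on $r,M$; with the choice above it does not depend on $r$). -/

import Mathlib

open MeasureTheory ProbabilityTheory Filter Topology

/-! ### The generalized attachment model and its genealogy

Times and labels start at `0`: the state after `n` steps is the state at time `n + 1` in the
usual numbering, and group `j` here is the `(j + 1)`-st group in order of appearance.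
Step `n` is driven by two variables. `b n` tells whether the new vertex founds a new group, and
`t n` is the existing group that the new vertex joins if it does not found a new one. `t n` is
also defined when `b n` is true: it is then the parent of the new group. -/

namespace GAM

/-- The number of groups that exist after `n` steps; their labels are `0, …, groupCount b n - 1`. -/
def groupCount (b : ℕ → Bool) : ℕ → ℕ
  | 0 => 1
  | n + 1 => groupCount b n + if b n = true then 1 else 0

/-- `groupSize b t n j` is the cardinality of group `j` after `n` steps. -/
def groupSize (b : ℕ → Bool) (t : ℕ → ℕ) : ℕ → ℕ → ℕ
  | 0, j => if j = 0 then 1 else 0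
  | n + 1, j =>
      if b n = true then
        if j = groupCount b n then 1 else groupSize b t n j
      else
        groupSize b t n j + if t n = j then 1 else 0

/-- `AtLevel b t j n`: group `j` is at distance `n` from the root, group `0`, in the genealogical
tree. The group founded at step `i` has the label `groupCount b i` and the parent `t i`. -/
inductive AtLevel (b : ℕ → Bool) (t : ℕ → ℕ) : ℕ → ℕ → Prop
  | root : AtLevel b t 0 0
  | child {i n : ℕ} : b i = true → AtLevel b t (t i) n → AtLevel b t (groupCount b i) (n + 1)

/-- The cardinality of group `j` tends to infinity. -/
def IsLeading (b : ℕ → Bool) (t : ℕ → ℕ) (j : ℕ) : Prop :=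
  Tendsto (fun n => groupSize b t n j) atTop atTop

/-- The set of the groups whose level in the genealogical tree is at least `n`. -/
def levelsFrom (b : ℕ → Bool) (t : ℕ → ℕ) (n : ℕ) : Set ℕ :=
  {j | ∃ k, n ≤ k ∧ AtLevel b t j k}

/-- `b`, `t` generate a generalized attachment model with reinforcement function `f` and
innovation probabilities `s`, which may be random. Here `ℱ n` is the history of the first `n`
steps. Given `ℱ n`, the variables `b n` and `t n` are independent, `b n` is Bernoulli with
mean `s n`, and `t n = k` with probability proportional to `f` of the cardinality of group `k`. -/
structure IsGAM {Ω : Type*} [mΩ : MeasurableSpace Ω] (μ : Measure Ω) (ℱ : Filtration ℕ mΩ)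
    (f : ℕ → ℝ) (s : ℕ → Ω → ℝ) (b : ℕ → Ω → Bool) (t : ℕ → Ω → ℕ) : Prop where
  measurable_b : ∀ n, Measurable[ℱ (n + 1)] (b n)
  measurable_t : ∀ n, Measurable[ℱ (n + 1)] (t n)
  measurable_s : ∀ n, Measurable[ℱ n] (s n)
  s_mem : ∀ n ω, s n ω ∈ Set.Icc (0 : ℝ) 1
  condProb : ∀ (n : ℕ) (β : Bool) (k : ℕ),
    μ[Set.indicator {ω | b n ω = β ∧ t n ω = k} (fun _ => (1 : ℝ)) | ℱ n] =ᵐ[μ]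
      fun ω => (if β = true then s n ω else 1 - s n ω) *
        (f (groupSize (fun i => b i ω) (fun i => t i ω) n k) /
          ∑ j ∈ Finset.range (groupCount (fun i => b i ω) n),
            f (groupSize (fun i => b i ω) (fun i => t i ω) n j))

/-- The event that the leading group belongs to the levels `≥ n` of the genealogical tree. -/
def leadEvent {Ω : Type*} (b : ℕ → Ω → Bool) (t : ℕ → Ω → ℕ) (n : ℕ) : Set Ω :=
  {ω | ∃ j ∈ levelsFrom (fun i => b i ω) (fun i => t i ω) n,
    IsLeading (fun i => b i ω) (fun i => t i ω) j}

/-! ### The constants -/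

/-- `θ_k`, where `θ_k² = 1 / ∑_{s > k} 2 / ((1 - p)² f(s)²)`. -/
noncomputable def theta (f : ℕ → ℝ) (p : ℝ) (k : ℕ) : ℝ :=
  Real.sqrt (1 / ∑' i : ℕ, 2 / ((1 - p) ^ 2 * f (k + 1 + i) ^ 2))

/-- `∏_{s = 1}^k 1 / (1 + θ_k / (f(s) (1 - p)))`. -/
noncomputable def weight (f : ℕ → ℝ) (p : ℝ) (k : ℕ) : ℝ :=
  ∏ s ∈ Finset.Icc 1 k, 1 / (1 + theta f p k / (f s * (1 - p)))

/-- `Φ(x) = 4 / (1 - p) * ∑_{k ≥ 0} weight_k * (f(1) (1 - p) + θ_k) / (f(1) (1 - p) + θ_k + x)`. -/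
noncomputable def Phi (f : ℕ → ℝ) (p x : ℝ) : ℝ :=
  4 / (1 - p) * ∑' k : ℕ, weight f p k *
    ((f 1 * (1 - p) + theta f p k) / (f 1 * (1 - p) + theta f p k + x))

/-- `m = 4 / (1 - p) * ∑_{k ≥ 0} weight_k`. -/
noncomputable def mConst (f : ℕ → ℝ) (p : ℝ) : ℝ :=
  4 / (1 - p) * ∑' k : ℕ, weight f p k

/-- `inf_{k ≥ 1} f(k)`. -/
noncomputable def minRate (f : ℕ → ℝ) : ℝ := ⨅ k : ℕ, f (k + 1)

/-- `C₁ = exp (inf f * ∑_{k ≥ 1} 1 / f(k))`. -/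
noncomputable def C₁ (f : ℕ → ℝ) : ℝ := Real.exp (minRate f * ∑' k : ℕ, 1 / f (k + 1))

/-- `C₂ = (1 - p) * inf f / 2`. -/
noncomputable def C₂ (f : ℕ → ℝ) (p : ℝ) : ℝ := (1 - p) * minRate f / 2

/-- The rate `c_n(M) = log (m / Φ(n / M)) - 1`; the same rate serves for every `r`. -/
noncomputable def rate (f : ℕ → ℝ) (p : ℝ) (n : ℕ) (M : ℝ) : ℝ :=
  Real.log (mConst f p / Phi f p (n / M)) - 1

end GAM

/-!
# The genealogical level of the leader in a generalized attachment model

Let `lam i = (1 - p) * f i` and `ρ = p / (1 - p)`. If step `n` is given the mean holding time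
`δ = (1 - s n) / ((1 - p) * ∑ j, f (size j))`, then group `k` grows with probability exactly
`δ * lam (size k)`, and has a child with probability at most `δ * ρ * lam (size k)`. So in this
time scale each group grows like a pure birth process with rates `lam i`, independently of the
others, and has children at rate at most `ρ * lam (size k)`. No continuous time is needed: the
`clock`, the sum of the mean holding times, is predictable, and since `1 + x * δ ≤ exp (x * δ)`
for both signs of `x`, a function `P` of the configuration whose expectation one step multiplies by
at most `1 + x * δ` gives the supermartingale `exp (-x * clock) * P`
(`IsGAM.lintegral_exp_clock_le`). Fatou's lemma and Markov's inequality turn it into a tail bound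
(`IsGAM.measure_le_of_eventually`), which is used twice.

With a negative `x` and the exponential moment of the time in which the root grows to infinity,
the clock exceeds `M` with probability at most `C₁ * exp (-M * C₂)`
(`IsGAM.measure_clock_gt_le`).

With `x = n / M`, the leaders of level `L ≥ n` are counted on the event that the clock stays below
`M`. A leader of level `L` has a line of ancestors, where each new member is born when its parent
has some size `κ + 1`; from then on the leader must reach infinity before all the members of its
line do. This is bounded by Chernoff's method with tilts: the line carries a tilt `Θ`, charged to
the growth time of its youngest member, and a birth at parent size `κ + 1` raises the tilt to
`max Θ (θ κ)`, the increment being credited to the remaining time of the parent. As credits and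
charges balance at any time, the resulting weight is a function of the configuration only, the
`potential`. Because the tilt is the running maximum, one record `κ` pays for all later smaller
ones, and `Rates.key_le` shows that each generation costs at most a factor
`exp 1 * ρ * ∑ κ, discWeight κ = exp 1 * p / 4 * Phi x`. The potential has the one-step bound
(`Rates.potential_step_le`), whence the expected number of leaders of level `L` is at most
`exp (x * M) * (exp 1 * p / 4 * Phi x) ^ L` (`IsGAM.measure_leader_level_le`). The spare factor
`exp 1 / 4 < 1` absorbs the geometric sum over `L ≥ n`. Finally
`mConst ^ n * exp (-(rate * n)) = (exp 1 * Phi (n / M)) ^ n`.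
-/

namespace GAM

/-! ### Tail products -/

/-- The tail product `∏_{s ≥ A} 1 / (1 + u s)`, written as the exponential of a series of
logarithms. It is meaningful when `u` is summable and `1 + u s > 0` for `s ≥ A`. -/
noncomputable def tailProd (u : ℕ → ℝ) (A : ℕ) : ℝ :=
  Real.exp (-∑' i, Real.log (1 + u (A + i)))

lemma tailProd_pos (u : ℕ → ℝ) (A : ℕ) : 0 < tailProd u A := Real.exp_pos _

lemma summable_comp_add {u : ℕ → ℝ} (hu : Summable u) (A : ℕ) : Summable fun i => u (A + i) := by
  simpa only [add_comm] using (summable_nat_add_iff A).2 hu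

lemma summable_log_comp_add {u : ℕ → ℝ} (hu : Summable u) (A : ℕ) :
    Summable fun i => Real.log (1 + u (A + i)) :=
  Real.summable_log_one_add_of_summable (summable_comp_add hu A)

lemma tailProd_eq_mul {u : ℕ → ℝ} (hu : Summable u) {A : ℕ} (hA : 0 < 1 + u A) :
    tailProd u A = 1 / (1 + u A) * tailProd u (A + 1) := by
  have h := (summable_log_comp_add hu A).tsum_eq_zero_add
  have h' : ∑' i, Real.log (1 + u (A + (i + 1))) = ∑' i, Real.log (1 + u (A + 1 + i)) := by
    congr 1; ext i; congr 3; omega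
  unfold tailProd
  rw [h, h', add_zero, neg_add, Real.exp_add, Real.exp_neg, Real.exp_log hA, one_div]

lemma tailProd_succ {u : ℕ → ℝ} (hu : Summable u) {A : ℕ} (hA : 0 < 1 + u A) :
    tailProd u (A + 1) = (1 + u A) * tailProd u A := by
  rw [tailProd_eq_mul hu hA]; field_simp

lemma tailProd_congr {u v : ℕ → ℝ} {A : ℕ} (h : ∀ s, A ≤ s → u s = v s) :
    tailProd u A = tailProd v A := by
  unfold tailProd
  congr 2; congr 1; ext i; rw [h _ (Nat.le_add_right A i)]

lemma tailProd_of_eq_zero {u : ℕ → ℝ} {A : ℕ} (h : ∀ s, A ≤ s → u s = 0) : tailProd u A = 1 := by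
  rw [tailProd_congr (v := fun _ => 0) h]; simp [tailProd]

lemma one_le_tailProd {u : ℕ → ℝ} {A : ℕ} (h : ∀ s, A ≤ s → u s ≤ 0)
    (h' : ∀ s, A ≤ s → 0 < 1 + u s) : 1 ≤ tailProd u A := by
  unfold tailProd
  rw [Real.one_le_exp_iff, neg_nonneg]
  exact tsum_nonpos fun i => Real.log_nonpos (h' _ (Nat.le_add_right A i)).le
    (by linarith [h _ (Nat.le_add_right A i)])

lemma tailProd_le_one {u : ℕ → ℝ} {A : ℕ} (h : ∀ s, A ≤ s → 0 ≤ u s) : tailProd u A ≤ 1 := by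
  unfold tailProd
  rw [Real.exp_le_one_iff, neg_nonpos]
  exact tsum_nonneg fun i => Real.log_nonneg (by linarith [h _ (Nat.le_add_right A i)])

lemma tailProd_le_succ {u : ℕ → ℝ} (hu : Summable u) {A : ℕ} (hA : 0 ≤ u A) :
    tailProd u A ≤ tailProd u (A + 1) := by
  rw [tailProd_succ hu (by linarith)]
  nlinarith [tailProd_pos u A]

lemma tailProd_one_eq_prod_mul {u : ℕ → ℝ} (hu : Summable u) (h : ∀ s, 1 ≤ s → 0 < 1 + u s)
    (k : ℕ) : tailProd u 1 = (∏ s ∈ Finset.Icc 1 k, 1 / (1 + u s)) * tailProd u (k + 1) := by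
  induction k with
  | zero => simp
  | succ k ih =>
    rw [ih, Finset.prod_Icc_succ_top (by omega), tailProd_eq_mul hu (h (k + 1) (by omega)),
      mul_assoc]

lemma tendsto_tailProd (u : ℕ → ℝ) : Tendsto (tailProd u) atTop (𝓝 1) := by
  have h := tendsto_sum_nat_add fun i => Real.log (1 + u i)
  have h2 := (Real.continuous_exp.tendsto _).comp h.neg
  rw [neg_zero, Real.exp_zero] at h2
  refine h2.congr fun A => ?_
  simp only [Function.comp, tailProd, add_comm]

lemma one_le_exp_two_mul_mul_one_sub {y : ℝ} (h0 : 0 ≤ y) (h1 : y ≤ 1 / 2) :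
    1 ≤ Real.exp (2 * y) * (1 - y) := by
  nlinarith [Real.add_one_le_exp (2 * y)]

/-- If `0 ≤ v s ≤ 1 / 2` for `s ≥ A`, then `∏_{s ≥ A} 1 / (1 - v s) ≤ exp (2 ∑_{s ≥ A} v s)`. -/
lemma tailProd_neg_le_exp {v : ℕ → ℝ} (hv : Summable v) {A : ℕ}
    (h0 : ∀ s, A ≤ s → 0 ≤ v s) (h1 : ∀ s, A ≤ s → v s ≤ 1 / 2) :
    tailProd (fun s => -v s) A ≤ Real.exp (2 * ∑' i, v (A + i)) := by
  unfold tailProd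
  rw [Real.exp_le_exp, ← tsum_mul_left, ← tsum_neg]
  refine (summable_log_comp_add hv.neg A).neg.tsum_le_tsum (fun i => ?_)
    ((summable_comp_add hv A).mul_left 2)
  have hA := Nat.le_add_right A i
  have h := one_le_exp_two_mul_mul_one_sub (h0 _ hA) (h1 _ hA)
  have h2 := Real.log_nonneg h
  rw [Real.log_mul (Real.exp_pos _).ne' (by linarith [h1 _ hA]), Real.log_exp] at h2
  simp only [sub_eq_add_neg] at h2 ⊢
  linarith

/-- The comparison behind the Chernoff bound: since
`(1 - (y - z)) * (1 + y) ≥ (1 - y ^ 2) * (1 + z)`, the tilt `y` is exchanged for `z` at the cost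
of a factor `1 / (1 - y ^ 2)` for each `s`. -/
lemma tailProd_mul_tailProd_le {y z : ℕ → ℝ} (hy : Summable y) (hz : Summable z) {A : ℕ} {c : ℝ}
    (hz0 : ∀ s, A ≤ s → 0 ≤ z s) (hy0 : ∀ s, A ≤ s → 0 ≤ y s)
    (hsq : HasSum (fun i => y (A + i) ^ 2) c) (hc : c ≤ 1 / 2) :
    tailProd (fun s => -(y s - z s)) A * tailProd y A ≤ Real.exp (2 * c) * tailProd z A := by
  unfold tailProd
  rw [← Real.exp_add, ← Real.exp_add, Real.exp_le_exp, ← hsq.tsum_eq, ← tsum_mul_left,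
    ← tsum_neg, ← tsum_neg, ← tsum_neg]
  have s1 := (summable_log_comp_add (hy.sub hz).neg A).neg
  have s2 := (summable_log_comp_add hy A).neg
  have s3 := (summable_log_comp_add hz A).neg
  have s4 := hsq.summable.mul_left 2
  refine (Summable.tsum_add s1 s2).symm.trans_le
    (((s1.add s2).tsum_le_tsum (fun i => ?_) (s4.add s3)).trans_eq (Summable.tsum_add s4 s3))
  have hA := Nat.le_add_right A i
  have hz' := hz0 _ hA
  have hy' := hy0 _ hA
  have hle : y (A + i) ^ 2 ≤ 1 / 2 := (le_hasSum hsq i fun _ _ => sq_nonneg _).trans hc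
  generalize y (A + i) = a at *
  generalize z (A + i) = d at *
  have ha1 : a < 1 := by nlinarith
  have h := one_le_exp_two_mul_mul_one_sub (sq_nonneg a) hle
  have p1 : 0 < 1 + -(a - d) := by linarith
  have p2 : 0 < 1 + a := by linarith
  have p3 : 0 < 1 + d := by linarith
  have key : 1 + d ≤ Real.exp (2 * a ^ 2) * ((1 + -(a - d)) * (1 + a)) := by
    have e1 : (1 - a ^ 2) * (1 + d) ≤ (1 + -(a - d)) * (1 + a) := by
      have := mul_nonneg (mul_nonneg hy' hz') p2.le
      nlinarith
    calc 1 + d ≤ (Real.exp (2 * a ^ 2) * (1 - a ^ 2)) * (1 + d) := by nlinarith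
      _ = Real.exp (2 * a ^ 2) * ((1 - a ^ 2) * (1 + d)) := by ring
      _ ≤ _ := by gcongr
  have h2 := Real.log_le_log p3 key
  rw [Real.log_mul (Real.exp_pos _).ne' (mul_pos p1 p2).ne', Real.log_exp,
    Real.log_mul p1.ne' p2.ne'] at h2
  linarith

/-! ### The tilts and the key inequality -/

/-- The growth rates `lam s` of a group of cardinality `s ≥ 1`, with finite total mean time to
infinity, and the tilts `θ κ`, normalized by `∑_{s > κ} (θ κ / lam s) ^ 2 = 1 / 2`. -/
structure Rates (lam θ : ℕ → ℝ) : Prop where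
  pos : ∀ s, 1 ≤ s → 0 < lam s
  summable_inv : Summable fun s => (lam s)⁻¹
  theta_nonneg : ∀ κ, 0 ≤ θ κ
  theta_mono : Monotone θ
  hasSum_sq : ∀ κ, HasSum (fun i => (θ κ / lam (κ + 1 + i)) ^ 2) (1 / 2)

/-- `growthTail lam x Θ A = ∏_{s ≥ A} lam s / (lam s + Θ)`, with `Θ + x` in place of `Θ` in the
factor for `s = 1`: the Laplace transform at `Θ` of the time that a group takes from size `A` to
infinity, with an additional discount `x` while it has size `1`. -/
noncomputable def growthTail (lam : ℕ → ℝ) (x Θ : ℝ) (A : ℕ) : ℝ :=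
  tailProd (fun s => (Θ + if s = 1 then x else 0) / lam s) A

/-- The `κ`-th summand of `Phi`, for general rates. -/
noncomputable def discWeight (lam θ : ℕ → ℝ) (x : ℝ) (κ : ℕ) : ℝ :=
  (∏ s ∈ Finset.Icc 1 κ, 1 / (1 + θ κ / lam s)) * ((lam 1 + θ κ) / (lam 1 + θ κ + x))

variable {lam θ : ℕ → ℝ}

lemma Rates.summable_div (h : Rates lam θ) (Θ : ℝ) : Summable fun s => Θ / lam s := by
  simpa only [div_eq_mul_inv] using h.summable_inv.mul_left Θ

lemma Rates.summable_growth (h : Rates lam θ) (x Θ : ℝ) :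
    Summable fun s => (Θ + if s = 1 then x else 0) / lam s := by
  simp only [add_div]
  refine (h.summable_div Θ).add (summable_of_ne_finset_zero (s := {1}) fun s hs => ?_)
  rw [if_neg (by simpa using hs), zero_div]

lemma Rates.growth_nonneg (h : Rates lam θ) {x Θ : ℝ} (hx : 0 ≤ x) (hΘ : 0 ≤ Θ) {s : ℕ}
    (hs : 1 ≤ s) : 0 ≤ (Θ + if s = 1 then x else 0) / lam s :=
  div_nonneg (by split_ifs <;> linarith) (h.pos s hs).le

lemma growthTail_pos (lam : ℕ → ℝ) (x Θ : ℝ) (A : ℕ) : 0 < growthTail lam x Θ A :=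
  tailProd_pos _ _

lemma Rates.growthTail_succ (h : Rates lam θ) {x Θ : ℝ} (hx : 0 ≤ x) (hΘ : 0 ≤ Θ) {A : ℕ}
    (hA : 1 ≤ A) : lam A * growthTail lam x Θ (A + 1) =
      (lam A + (Θ + if A = 1 then x else 0)) * growthTail lam x Θ A := by
  have h1 := h.growth_nonneg hx hΘ hA
  have hl := h.pos A hA
  unfold growthTail
  rw [tailProd_succ (h.summable_growth x Θ) (by linarith)]
  field_simp

lemma growthTail_of_two_le (lam : ℕ → ℝ) (x Θ : ℝ) {A : ℕ} (hA : 2 ≤ A) :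
    growthTail lam x Θ A = tailProd (fun s => Θ / lam s) A :=
  tailProd_congr fun s hs => by rw [if_neg (by omega), add_zero]

lemma Rates.growthTail_one_eq (h : Rates lam θ) {x : ℝ} (hx : 0 ≤ x) (κ : ℕ) :
    growthTail lam x (θ κ) 1 =
      discWeight lam θ x κ * tailProd (fun s => θ κ / lam s) (κ + 1) := by
  have hΘ := h.theta_nonneg κ
  have hl := h.pos 1 le_rfl
  have hd : ∀ s, 1 ≤ s → 0 ≤ θ κ / lam s := fun s hs => div_nonneg hΘ (h.pos s hs).le
  have h1 := tailProd_one_eq_prod_mul (h.summable_div (θ κ))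
    (fun s hs => by linarith [hd s hs]) κ
  have h2 := tailProd_succ (h.summable_div (θ κ)) (A := 1) (by linarith [hd 1 le_rfl])
  have h3 := h.growthTail_succ hx hΘ (le_refl 1)
  rw [growthTail_of_two_le _ _ _ le_rfl, h2, if_pos rfl, h1] at h3
  have h4 : growthTail lam x (θ κ) 1 = lam 1 * ((1 + θ κ / lam 1) *
      ((∏ s ∈ Finset.Icc 1 κ, 1 / (1 + θ κ / lam s)) *
        tailProd (fun s => θ κ / lam s) (κ + 1))) / (lam 1 + (θ κ + x)) := by
    rw [eq_div_iff (by positivity), h3]; ring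
  rw [h4, discWeight, ← add_assoc]
  field_simp

/-- The key inequality. A group with tilt `Θ` that has a child at size `κ + 1` raises the tilt to
`max Θ (θ κ)`; the resulting weight is at most `discWeight κ` times a constant. -/
lemma Rates.key_le (h : Rates lam θ) {x Θ : ℝ} (hx : 0 ≤ x) (hΘ : 0 ≤ Θ) (κ : ℕ) :
    tailProd (fun s => -(max Θ (θ κ) - Θ) / lam s) (κ + 1) * growthTail lam x (max Θ (θ κ)) 1 ≤
      Real.exp 1 * discWeight lam θ x κ * growthTail lam x Θ (κ + 2) := by
  have hθ := h.theta_nonneg κ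
  have hl := h.pos 1 le_rfl
  have hw : 0 ≤ discWeight lam θ x κ := mul_nonneg
    (Finset.prod_nonneg fun s hs => one_div_nonneg.2 (add_nonneg zero_le_one
      (div_nonneg hθ (h.pos s (Finset.mem_Icc.1 hs).1).le))) (by positivity)
  have hd : ∀ {Θ : ℝ}, 0 ≤ Θ → ∀ s, 1 ≤ s → 0 ≤ Θ / lam s := fun hΘ s hs =>
    div_nonneg hΘ (h.pos s hs).le
  rcases le_total (θ κ) Θ with hle | hle
  · rw [max_eq_left hle, tailProd_of_eq_zero (by simp), one_mul]
    have e1 := tailProd_one_eq_prod_mul (h.summable_growth x Θ)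
      (fun s hs => by linarith [h.growth_nonneg hx hΘ hs]) (κ + 1)
    have e2 := tailProd_one_eq_prod_mul (h.summable_growth x (θ κ))
      (fun s hs => by linarith [h.growth_nonneg hx hθ hs]) (κ + 1)
    set p1 := ∏ s ∈ Finset.Icc 1 (κ + 1), 1 / (1 + (Θ + if s = 1 then x else 0) / lam s)
    set p2 := ∏ s ∈ Finset.Icc 1 (κ + 1), 1 / (1 + (θ κ + if s = 1 then x else 0) / lam s)
    have hp : p1 ≤ p2 := by
      refine Finset.prod_le_prod (fun s hs => ?_) fun s hs => ?_
      · have := h.growth_nonneg hx hΘ (Finset.mem_Icc.1 hs).1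
        positivity
      · have := h.growth_nonneg hx hθ (Finset.mem_Icc.1 hs).1
        have := h.pos s (Finset.mem_Icc.1 hs).1
        gcongr
    have hp2 : p2 ≤ discWeight lam θ x κ := by
      have e3 := h.growthTail_one_eq hx κ
      have e4 : tailProd (fun s => θ κ / lam s) (κ + 1) ≤ growthTail lam x (θ κ) (κ + 2) := by
        rw [growthTail_of_two_le _ _ _ (by omega)]
        exact tailProd_le_succ (h.summable_div _) (hd hθ _ (by omega))
      refine le_of_mul_le_mul_right (a := growthTail lam x (θ κ) (κ + 2)) ?_
        (growthTail_pos _ _ _ _)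
      calc p2 * growthTail lam x (θ κ) (κ + 2) = growthTail lam x (θ κ) 1 := e2.symm
        _ ≤ _ := by rw [e3]; gcongr
    have hexp : (1 : ℝ) ≤ Real.exp 1 := Real.one_le_exp zero_le_one
    calc growthTail lam x Θ 1 = p1 * growthTail lam x Θ (κ + 2) := e1
      _ ≤ (Real.exp 1 * discWeight lam θ x κ) * growthTail lam x Θ (κ + 2) := by
        refine mul_le_mul_of_nonneg_right ?_ (growthTail_pos _ _ _ _).le
        nlinarith
  · rw [max_eq_right hle, h.growthTail_one_eq hx κ, growthTail_of_two_le _ _ _ (by omega)]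
    have e1 := tailProd_mul_tailProd_le (A := κ + 1) (h.summable_div (θ κ)) (h.summable_div Θ)
      (fun s hs => hd hΘ s (by omega)) (fun s hs => hd hθ s (by omega)) (h.hasSum_sq κ) le_rfl
    have e2 : tailProd (fun s => Θ / lam s) (κ + 1) ≤ tailProd (fun s => Θ / lam s) (κ + 2) :=
      tailProd_le_succ (h.summable_div _) (hd hΘ _ (by omega))
    have e3 : (fun s => -(θ κ - Θ) / lam s) = fun s => -(θ κ / lam s - Θ / lam s) := by
      ext s; ring
    rw [e3]
    calc _ = discWeight lam θ x κ * (tailProd (fun s => -(θ κ / lam s - Θ / lam s)) (κ + 1) *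
          tailProd (fun s => θ κ / lam s) (κ + 1)) := by ring
      _ ≤ discWeight lam θ x κ * (Real.exp (2 * (1 / 2)) *
          tailProd (fun s => Θ / lam s) (κ + 1)) := by gcongr
      _ ≤ discWeight lam θ x κ * (Real.exp (2 * (1 / 2)) *
          tailProd (fun s => Θ / lam s) (κ + 2)) := by gcongr
      _ = _ := by norm_num; ring

lemma Rates.theta_lt (h : Rates lam θ) {κ s : ℕ} (hs : κ + 1 ≤ s) : θ κ < lam s := by
  have hl := h.pos s (by omega)
  obtain ⟨i, rfl⟩ := Nat.exists_eq_add_of_le hs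
  have h1 := le_hasSum (h.hasSum_sq κ) i fun _ _ => sq_nonneg _
  have h2 : θ κ / lam (κ + 1 + i) < 1 := by nlinarith
  rwa [div_lt_one hl] at h2

end GAM

namespace GAM

/-! ### Configurations of tilted groups -/

/-- A state of the attachment model, with additional data for the Chernoff bound along the
ancestral line of each group `j < count`: its `level` in the genealogical tree, and for each
proper ancestor `q` an exponent `expo j q` that rewards a long remaining time to infinity of
group `q`. The `tilt` of `j` is the sum of these exponents, and is charged to the growth time of
group `j` itself. -/
structure Config where
  count : ℕ
  size : ℕ → ℕ
  level : ℕ → ℕ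
  tilt : ℕ → ℝ
  expo : ℕ → ℕ → ℝ

namespace Config

/-- One group, the root, of size `1`. -/
noncomputable def init : Config where
  count := 1
  size j := if j = 0 then 1 else 0
  level _ := 0
  tilt _ := 0
  expo _ _ := 0

/-- Group `k` grows by one. -/
def grow (C : Config) (k : ℕ) : Config :=
  { C with size := fun j => C.size j + if k = j then 1 else 0 }

/-- The tilt of a child of group `k` that is born now. -/
noncomputable def childTilt (θ : ℕ → ℝ) (C : Config) (k : ℕ) : ℝ :=
  max (C.tilt k) (θ (C.size k - 1))

/-- Group `k` has a child. The child inherits the exponents of group `k`, and the exponent of the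
ancestor `k` is what raises the tilt to its new value. -/
noncomputable def birth (θ : ℕ → ℝ) (C : Config) (k : ℕ) : Config where
  count := C.count + 1
  size j := if j = C.count then 1 else C.size j
  level j := if j = C.count then C.level k + 1 else C.level j
  tilt j := if j = C.count then C.childTilt θ k else C.tilt j
  expo j q := if j = C.count then
    C.expo k q + (if q = k then C.childTilt θ k - C.tilt k else 0) else C.expo j q

/-- The invariants of the configurations that the model can reach. -/
structure Good (θ : ℕ → ℝ) (C : Config) : Prop where
  count_pos : 0 < C.count
  size_pos : ∀ j, j < C.count → 1 ≤ C.size j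
  size_zero : ∀ j, C.count ≤ j → C.size j = 0
  expo_nonneg : ∀ j q, j < C.count → 0 ≤ C.expo j q
  expo_zero : ∀ j q, j < C.count → j ≤ q → C.expo j q = 0
  expo_le : ∀ j q, j < C.count → q < C.count → C.expo j q ≤ θ (C.size q - 1)
  expo_sum : ∀ j, j < C.count → ∑ q ∈ Finset.range C.count, C.expo j q = C.tilt j

variable {lam θ : ℕ → ℝ} {C : Config}

lemma Good.tilt_nonneg (hC : C.Good θ) {j : ℕ} (hj : j < C.count) : 0 ≤ C.tilt j := by
  rw [← hC.expo_sum j hj]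
  exact Finset.sum_nonneg fun q _ => hC.expo_nonneg j q hj

lemma good_init (h : Rates lam θ) : init.Good θ where
  count_pos := Nat.one_pos
  size_pos j hj := by simp [init] at hj ⊢; simp [hj]
  size_zero j hj := by simp [init] at hj ⊢; omega
  expo_nonneg _ _ _ := le_rfl
  expo_zero _ _ _ _ := rfl
  expo_le _ _ _ _ := h.theta_nonneg _
  expo_sum _ _ := by simp [init]

lemma Good.grow (h : Rates lam θ) (hC : C.Good θ) {k : ℕ} (hk : k < C.count) :
    (C.grow k).Good θ where
  count_pos := hC.count_pos
  size_pos j hj := (hC.size_pos j hj).trans (Nat.le_add_right _ _)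
  size_zero j hj := by
    have hj' : C.count ≤ j := hj
    simp only [Config.grow, hC.size_zero j hj', if_neg (show k ≠ j by omega)]
  expo_nonneg := hC.expo_nonneg
  expo_zero := hC.expo_zero
  expo_le j q hj hq := (hC.expo_le j q hj hq).trans
    (h.theta_mono (Nat.sub_le_sub_right (Nat.le_add_right _ _) 1))
  expo_sum := hC.expo_sum

lemma tilt_le_childTilt (θ : ℕ → ℝ) (C : Config) (k : ℕ) : C.tilt k ≤ C.childTilt θ k :=
  le_max_left _ _

lemma Good.birth (h : Rates lam θ) (hC : C.Good θ) {k : ℕ} (hk : k < C.count) :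
    (C.birth θ k).Good θ where
  count_pos := Nat.succ_pos _
  size_pos j hj := by
    have hj' : j < C.count + 1 := hj
    simp only [Config.birth]
    split_ifs with h1
    · exact le_rfl
    · exact hC.size_pos j (by omega)
  size_zero j hj := by
    have hj' : C.count + 1 ≤ j := hj
    simp only [Config.birth, if_neg (show j ≠ C.count by omega)]
    exact hC.size_zero j (by omega)
  expo_nonneg j q hj := by
    have hj' : j < C.count + 1 := hj
    have := tilt_le_childTilt θ C k
    simp only [Config.birth]
    split_ifs with h1 h2
    · exact add_nonneg (hC.expo_nonneg k q hk) (by linarith)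
    · simpa using hC.expo_nonneg k q hk
    · exact hC.expo_nonneg j q (by omega)
  expo_zero j q hj hq := by
    have hj' : j < C.count + 1 := hj
    simp only [Config.birth]
    split_ifs with h1 h2
    · omega
    · simpa using hC.expo_zero k q hk (by omega)
    · exact hC.expo_zero j q (by omega) hq
  expo_le j q hj hq := by
    have hj' : j < C.count + 1 := hj
    have hq' : q < C.count + 1 := hq
    have h0 := hC.tilt_nonneg hk
    simp only [Config.birth]
    rcases Nat.lt_succ_iff_lt_or_eq.1 hq' with hqc | hqc
    · rw [if_neg (show ¬ q = C.count by omega)]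
      split_ifs with h1 h2
      · subst h2
        rw [hC.expo_zero q q hk le_rfl, childTilt, zero_add, sub_le_iff_le_add]
        exact max_le (le_add_of_nonneg_left (h.theta_nonneg _)) (le_add_of_nonneg_right h0)
      · simpa using hC.expo_le k q hk hqc
      · exact hC.expo_le j q (by omega) hqc
    · rw [if_neg (show ¬ q = k by omega), hC.expo_zero k q hk (by omega)]
      have := h.theta_nonneg
      split_ifs with h1
      · simpa using this _
      · rw [hC.expo_zero j q (by omega) (by omega)]; exact this _
  expo_sum j hj := by
    have hj' : j < C.count + 1 := hj
    simp only [Config.birth]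
    rw [Finset.sum_range_succ]
    split_ifs with h1 h2
    · omega
    · rw [Finset.sum_add_distrib, hC.expo_sum k hk, Finset.sum_ite_eq', if_pos (by simpa using hk),
        hC.expo_zero k _ hk (by omega)]
      ring
    · rw [hC.expo_sum j (by omega), hC.expo_zero j _ (by omega) (by omega), add_zero]

end Config

/-! ### The potential of a configuration -/

/-- The reward collected from the remaining growth times of the proper ancestors of `j`. -/
noncomputable def pathWeight (lam : ℕ → ℝ) (C : Config) (j : ℕ) : ℝ :=
  ∏ q ∈ Finset.range C.count, tailProd (fun s => -C.expo j q / lam s) (C.size q)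

/-- `exp 1 * ρ * ∑_{κ ≥ k} discWeight κ`: this bounds the expected weight of the children that a
group has from the size `k + 1` on. -/
noncomputable def childTail (lam θ : ℕ → ℝ) (x ρ : ℝ) (k : ℕ) : ℝ :=
  Real.exp 1 * ρ * ∑' i, discWeight lam θ x (k + i)

/-- An upper bound for the expected weight of the descendants at level `L` of a group of level `l`
and size `A`, relative to the weight of the group itself. -/
noncomputable def levelWeight (lam θ : ℕ → ℝ) (x ρ : ℝ) (L l A : ℕ) : ℝ :=
  if l < L then childTail lam θ x ρ 0 ^ (L - l - 1) * childTail lam θ x ρ (A - 1)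
  else if l = L then 1 else 0

/-- An upper bound for the expected discounted number of groups at level `L` that will win
against all their ancestors, as a function of the present configuration. -/
noncomputable def potential (lam θ : ℕ → ℝ) (x ρ : ℝ) (L : ℕ) (C : Config) : ℝ :=
  ∑ j ∈ Finset.range C.count, pathWeight lam C j *
    (levelWeight lam θ x ρ L (C.level j) (C.size j) *
      growthTail lam x (C.tilt j) (C.size j))

variable {lam θ : ℕ → ℝ} {C : Config} {x ρ : ℝ}

lemma Rates.one_sub_pos (h : Rates lam θ) (hC : C.Good θ) {j q s : ℕ} (hj : j < C.count)
    (hq : q < C.count) (hs : C.size q ≤ s) : 0 < 1 + -C.expo j q / lam s := by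
  have h1 := hC.expo_le j q hj hq
  have h2 := hC.size_pos q hq
  have h3 := h.theta_lt (κ := C.size q - 1) (s := s) (by omega)
  have h4 := h.pos s (by omega)
  have : C.expo j q / lam s < 1 := by rw [div_lt_one h4]; linarith
  rw [neg_div]; linarith

lemma Rates.one_le_pathWeight (h : Rates lam θ) (hC : C.Good θ) {j : ℕ} (hj : j < C.count) :
    1 ≤ pathWeight lam C j := by
  refine Finset.one_le_prod fun q hq => ?_
  have hq' := Finset.mem_range.1 hq
  refine one_le_tailProd (fun s hs => ?_) fun s hs => h.one_sub_pos hC hj hq' hs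
  have h1 := hC.size_pos q hq'
  exact div_nonpos_of_nonpos_of_nonneg (neg_nonpos.2 (hC.expo_nonneg j q hj))
    (h.pos s (by omega)).le

lemma pathWeight_pos (lam : ℕ → ℝ) (C : Config) (j : ℕ) : 0 < pathWeight lam C j :=
  Finset.prod_pos fun _ _ => tailProd_pos _ _

lemma Rates.pathWeight_grow (h : Rates lam θ) (hC : C.Good θ) {j k : ℕ} (hj : j < C.count)
    (hk : k < C.count) :
    pathWeight lam (C.grow k) j = (1 - C.expo j k / lam (C.size k)) * pathWeight lam C j := by
  have hk' : k ∈ Finset.range C.count := by simpa using hk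
  have e1 : (C.grow k).count = C.count := rfl
  unfold pathWeight
  rw [e1, ← Finset.mul_prod_erase _ _ hk', ← Finset.mul_prod_erase _ _ hk', ← mul_assoc]
  congr 1
  · simp only [Config.grow, if_true]
    rw [tailProd_succ (h.summable_div _) (h.one_sub_pos hC hj hk le_rfl), neg_div, ← sub_eq_add_neg]
  · refine Finset.prod_congr rfl fun q hq => ?_
    simp [Config.grow, (Finset.ne_of_mem_erase hq).symm]

lemma pathWeight_birth_of_lt (hC : C.Good θ) {j : ℕ} (k : ℕ) (hj : j < C.count) :
    pathWeight lam (C.birth θ k) j = pathWeight lam C j := by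
  unfold pathWeight
  simp only [Config.birth, if_neg hj.ne]
  rw [Finset.prod_range_succ, tailProd_of_eq_zero, mul_one]
  · exact Finset.prod_congr rfl fun q hq => by rw [if_neg (Finset.mem_range.1 hq).ne]
  · simp [hC.expo_zero j C.count hj hj.le]

lemma pathWeight_birth_new (hC : C.Good θ) {k : ℕ} (hk : k < C.count) :
    pathWeight lam (C.birth θ k) C.count = pathWeight lam C k *
      tailProd (fun s => -(C.childTilt θ k - C.tilt k) / lam s) (C.size k) := by
  have hk' : k ∈ Finset.range C.count := by simpa using hk
  unfold pathWeight
  simp only [Config.birth, if_true]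
  rw [Finset.prod_range_succ, tailProd_of_eq_zero, mul_one, ← Finset.mul_prod_erase _ _ hk',
    ← Finset.mul_prod_erase (Finset.range C.count) _ hk']
  · rw [if_neg hk.ne, hC.expo_zero k k hk le_rfl, tailProd_of_eq_zero (u := fun s => -0 / lam s)
      (by simp), one_mul, if_pos rfl, zero_add, mul_comm]
    congr 1
    refine Finset.prod_congr rfl fun q hq => ?_
    rw [if_neg (Finset.ne_of_mem_erase hq),
      if_neg (Finset.mem_range.1 (Finset.mem_of_mem_erase hq)).ne, add_zero]
  · simp [hC.expo_zero k C.count hk hk.le, hk.ne']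

lemma Rates.discWeight_pos (h : Rates lam θ) (hx : 0 ≤ x) (κ : ℕ) :
    0 < discWeight lam θ x κ := by
  have hθ := h.theta_nonneg κ
  have hl := h.pos 1 le_rfl
  refine mul_pos (Finset.prod_pos fun s hs => ?_) (by positivity)
  have := div_nonneg hθ (h.pos s (Finset.mem_Icc.1 hs).1).le
  positivity

lemma Rates.childTail_nonneg (h : Rates lam θ) (hx : 0 ≤ x) (hρ : 0 ≤ ρ) (k : ℕ) :
    0 ≤ childTail lam θ x ρ k :=
  mul_nonneg (by positivity) (tsum_nonneg fun i => (h.discWeight_pos hx _).le)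

lemma childTail_eq_add (hw : Summable (discWeight lam θ x)) (k : ℕ) :
    childTail lam θ x ρ k =
      Real.exp 1 * ρ * discWeight lam θ x k + childTail lam θ x ρ (k + 1) := by
  unfold childTail
  rw [(summable_comp_add hw k).tsum_eq_zero_add, mul_add, add_zero]
  congr 3; ext i; congr 1; omega

lemma Rates.levelWeight_nonneg (h : Rates lam θ) (hx : 0 ≤ x) (hρ : 0 ≤ ρ) (L l A : ℕ) :
    0 ≤ levelWeight lam θ x ρ L l A := by
  have := h.childTail_nonneg hx hρ
  unfold levelWeight
  split_ifs
  · exact mul_nonneg (pow_nonneg (this _) _) (this _)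
  · exact zero_le_one
  · exact le_rfl

/-- The weight of level `L` in the potential decreases, as a group passes from size `A` to size
`A + 1`, by as much as a child born at size `A` needs. -/
lemma Rates.levelWeight_step (h : Rates lam θ) (hw : Summable (discWeight lam θ x)) (hx : 0 ≤ x)
    (hρ : 0 ≤ ρ) (L l : ℕ) {A : ℕ} (hA : 1 ≤ A) {Θ : ℝ} (hΘ : 0 ≤ Θ) :
    levelWeight lam θ x ρ L l (A + 1) * growthTail lam x Θ (A + 1) +
      ρ * (tailProd (fun s => -(max Θ (θ (A - 1)) - Θ) / lam s) A *
        (levelWeight lam θ x ρ L (l + 1) 1 * growthTail lam x (max Θ (θ (A - 1))) 1)) ≤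
    levelWeight lam θ x ρ L l A * growthTail lam x Θ (A + 1) := by
  obtain ⟨κ, rfl⟩ := Nat.exists_eq_add_of_le' hA
  have hkey := h.key_le hx hΘ κ
  unfold levelWeight
  simp only [Nat.add_sub_cancel]
  by_cases hl : l < L
  · have e1 : (if l + 1 < L then childTail lam θ x ρ 0 ^ (L - (l + 1) - 1) *
        childTail lam θ x ρ (1 - 1) else if l + 1 = L then 1 else 0) =
        childTail lam θ x ρ 0 ^ (L - l - 1) := by
      split_ifs with h1 h2
      · rw [show L - l - 1 = L - (l + 1) - 1 + 1 by omega, pow_succ]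
      · rw [show L - l - 1 = 0 by omega, pow_zero]
      · omega
    rw [e1, if_pos hl, if_pos hl, childTail_eq_add hw κ]
    have hpow : 0 ≤ childTail lam θ x ρ 0 ^ (L - l - 1) :=
      pow_nonneg (h.childTail_nonneg hx hρ _) _
    generalize childTail lam θ x ρ 0 ^ (L - l - 1) = a at *
    have := mul_le_mul_of_nonneg_left hkey (mul_nonneg hpow hρ)
    linarith
  · rw [if_neg hl, if_neg hl, if_neg (show ¬ l + 1 < L by omega),
      if_neg (show ¬ l + 1 = L by omega)]
    simp

/-- The growth of a group of size `A` and its births cost at most `Θ + x` times its own weight.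
The part `Θ` is what the growth of its ancestors makes up for. -/
lemma Rates.tip_le (h : Rates lam θ) (hw : Summable (discWeight lam θ x)) (hx : 0 ≤ x)
    (hρ : 0 ≤ ρ) (L l : ℕ) {A : ℕ} (hA : 1 ≤ A) {Θ : ℝ} (hΘ : 0 ≤ Θ) :
    lam A * (levelWeight lam θ x ρ L l (A + 1) * growthTail lam x Θ (A + 1)) +
      ρ * lam A * (tailProd (fun s => -(max Θ (θ (A - 1)) - Θ) / lam s) A *
        (levelWeight lam θ x ρ L (l + 1) 1 * growthTail lam x (max Θ (θ (A - 1))) 1)) ≤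
    (lam A + Θ + x) * (levelWeight lam θ x ρ L l A * growthTail lam x Θ A) := by
  have h1 := mul_le_mul_of_nonneg_left (h.levelWeight_step hw hx hρ L l hA hΘ) (h.pos A hA).le
  have h2 := h.growthTail_succ hx hΘ hA
  have h3 := h.levelWeight_nonneg hx hρ L l A
  have h4 := mul_nonneg h3 (growthTail_pos lam x Θ A).le
  have h5 : (if A = 1 then x else 0) ≤ x := by split_ifs <;> linarith
  calc _ = lam A * (levelWeight lam θ x ρ L l (A + 1) * growthTail lam x Θ (A + 1) +
      ρ * (tailProd (fun s => -(max Θ (θ (A - 1)) - Θ) / lam s) A *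
        (levelWeight lam θ x ρ L (l + 1) 1 * growthTail lam x (max Θ (θ (A - 1))) 1))) := by ring
    _ ≤ lam A * (levelWeight lam θ x ρ L l A * growthTail lam x Θ (A + 1)) := h1
    _ = levelWeight lam θ x ρ L l A * (lam A * growthTail lam x Θ (A + 1)) := by ring
    _ = (lam A + Θ + if A = 1 then x else 0) *
        (levelWeight lam θ x ρ L l A * growthTail lam x Θ A) := by rw [h2]; ring
    _ ≤ _ := mul_le_mul_of_nonneg_right (by linarith) h4

lemma potential_birth (hC : C.Good θ) (L : ℕ) {k : ℕ} (hk : k < C.count) :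
    potential lam θ x ρ L (C.birth θ k) = potential lam θ x ρ L C +
      pathWeight lam C k * (tailProd (fun s => -(C.childTilt θ k - C.tilt k) / lam s) (C.size k) *
        (levelWeight lam θ x ρ L (C.level k + 1) 1 * growthTail lam x (C.childTilt θ k) 1)) := by
  unfold potential
  rw [show (C.birth θ k).count = C.count + 1 from rfl, Finset.sum_range_succ,
    pathWeight_birth_new hC hk]
  congr 1
  · refine Finset.sum_congr rfl fun j hj => ?_
    rw [pathWeight_birth_of_lt hC k (Finset.mem_range.1 hj)]
    simp [Config.birth, (Finset.mem_range.1 hj).ne]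
  · simp [Config.birth, mul_assoc]

lemma Rates.sum_grow_sub (h : Rates lam θ) (hC : C.Good θ) {j : ℕ} (hj : j < C.count)
    (v : ℕ → ℝ) :
    ∑ k ∈ Finset.range C.count, lam (C.size k) *
      (pathWeight lam (C.grow k) j * v ((C.grow k).size j) - pathWeight lam C j * v (C.size j)) =
    pathWeight lam C j * (lam (C.size j) * (v (C.size j + 1) - v (C.size j)) -
      C.tilt j * v (C.size j)) := by
  have hj' : j ∈ Finset.range C.count := by simpa using hj
  rw [← hC.expo_sum j hj, ← Finset.add_sum_erase _ _ hj', ← Finset.add_sum_erase _ _ hj',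
    hC.expo_zero j j hj le_rfl, h.pathWeight_grow hC hj hj, hC.expo_zero j j hj le_rfl]
  have e : ∀ k ∈ (Finset.range C.count).erase j, lam (C.size k) *
      (pathWeight lam (C.grow k) j * v ((C.grow k).size j) - pathWeight lam C j * v (C.size j)) =
      -(pathWeight lam C j * v (C.size j)) * C.expo j k := by
    intro k hk
    have hk' := Finset.mem_range.1 (Finset.mem_of_mem_erase hk)
    have hl := h.pos _ (hC.size_pos k hk')
    rw [h.pathWeight_grow hC hj hk']
    simp only [Config.grow, if_neg (Finset.ne_of_mem_erase hk), add_zero]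
    field_simp
    ring
  rw [Finset.sum_congr rfl e, ← Finset.mul_sum]
  simp only [Config.grow, if_true]
  ring

/-- The one-step bound. Here `δ` is the inverse of the total rate, `δ * lam (C.size k)` is the
probability that `k` grows, and `β k` the probability that `k` has a child. -/
lemma Rates.potential_step_le (h : Rates lam θ) (hw : Summable (discWeight lam θ x)) (hx : 0 ≤ x)
    (hρ : 0 ≤ ρ) (hC : C.Good θ) (L : ℕ) {δ : ℝ} (hδ : 0 ≤ δ) {β : ℕ → ℝ}
    (hβ : ∀ k < C.count, β k ≤ δ * (ρ * lam (C.size k)))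
    (hone : ∑ k ∈ Finset.range C.count, (δ * lam (C.size k) + β k) = 1) :
    ∑ k ∈ Finset.range C.count, (δ * lam (C.size k) * potential lam θ x ρ L (C.grow k) +
      β k * potential lam θ x ρ L (C.birth θ k)) ≤ (1 + x * δ) * potential lam θ x ρ L C := by
  set V : ℕ → ℕ → ℝ := fun j A =>
    levelWeight lam θ x ρ L (C.level j) A * growthTail lam x (C.tilt j) A with hV
  set N : ℕ → ℝ := fun k => tailProd (fun s => -(C.childTilt θ k - C.tilt k) / lam s) (C.size k) *
        (levelWeight lam θ x ρ L (C.level k + 1) 1 * growthTail lam x (C.childTilt θ k) 1) with hN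
  have hN0 : ∀ k, 0 ≤ N k := fun k => mul_nonneg (tailProd_pos _ _).le
    (mul_nonneg (h.levelWeight_nonneg hx hρ _ _ _) (growthTail_pos _ _ _ _).le)
  set W : ℝ := potential lam θ x ρ L C with hW
  have hW' : W = ∑ j ∈ Finset.range C.count, pathWeight lam C j * V j (C.size j) := rfl
  have hg : ∀ k, potential lam θ x ρ L (C.grow k) - W = ∑ j ∈ Finset.range C.count,
      (pathWeight lam (C.grow k) j * V j ((C.grow k).size j) -
        pathWeight lam C j * V j (C.size j)) := by
    intro k
    rw [hW', Finset.sum_sub_distrib]; rfl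
  calc _ = ∑ k ∈ Finset.range C.count, ((δ * lam (C.size k) + β k) * W +
        δ * (lam (C.size k) * (potential lam θ x ρ L (C.grow k) - W)) +
        β k * (pathWeight lam C k * N k)) := by
        refine Finset.sum_congr rfl fun k hk => ?_
        rw [potential_birth hC L (Finset.mem_range.1 hk)]
        ring
    _ = W + δ * (∑ k ∈ Finset.range C.count, lam (C.size k) *
          (potential lam θ x ρ L (C.grow k) - W)) +
        ∑ k ∈ Finset.range C.count, β k * (pathWeight lam C k * N k) := by
        rw [Finset.sum_add_distrib, Finset.sum_add_distrib, ← Finset.sum_mul, hone, one_mul,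
          Finset.mul_sum]
    _ = W + δ * (∑ j ∈ Finset.range C.count, pathWeight lam C j *
          (lam (C.size j) * (V j (C.size j + 1) - V j (C.size j)) - C.tilt j * V j (C.size j))) +
        ∑ k ∈ Finset.range C.count, β k * (pathWeight lam C k * N k) := by
        congr 3
        simp_rw [hg, Finset.mul_sum]
        rw [Finset.sum_comm]
        exact Finset.sum_congr rfl fun j hj =>
          h.sum_grow_sub hC (Finset.mem_range.1 hj) (V j)
    _ ≤ W + δ * (∑ j ∈ Finset.range C.count, pathWeight lam C j *
          (lam (C.size j) * (V j (C.size j + 1) - V j (C.size j)) - C.tilt j * V j (C.size j))) +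
        ∑ k ∈ Finset.range C.count, δ * (ρ * lam (C.size k)) * (pathWeight lam C k * N k) := by
        gcongr with k hk
        · exact mul_nonneg (pathWeight_pos _ _ _).le (hN0 k)
        · exact hβ k (Finset.mem_range.1 hk)
    _ = W + δ * ∑ j ∈ Finset.range C.count, pathWeight lam C j *
          (lam (C.size j) * V j (C.size j + 1) + ρ * lam (C.size j) * N j -
            (lam (C.size j) + C.tilt j) * V j (C.size j)) := by
        rw [add_assoc, Finset.mul_sum, ← Finset.sum_add_distrib, Finset.mul_sum]
        congr 1
        exact Finset.sum_congr rfl fun j _ => by ring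
    _ ≤ W + δ * ∑ j ∈ Finset.range C.count, pathWeight lam C j * (x * V j (C.size j)) := by
        gcongr with j hj
        · exact (pathWeight_pos _ _ _).le
        · have hj' := Finset.mem_range.1 hj
          have := h.tip_le hw hx hρ L (C.level j) (hC.size_pos j hj') (hC.tilt_nonneg hj')
          simp only [hV, hN, Config.childTilt]
          linarith
    _ = (1 + x * δ) * W := by
        rw [hW', Finset.mul_sum, Finset.mul_sum, ← Finset.sum_add_distrib]
        exact Finset.sum_congr rfl fun j _ => by ring

lemma Rates.potential_nonneg (h : Rates lam θ) (hx : 0 ≤ x) (hρ : 0 ≤ ρ) (L : ℕ) (C : Config) :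
    0 ≤ potential lam θ x ρ L C :=
  Finset.sum_nonneg fun _ _ => mul_nonneg (pathWeight_pos _ _ _).le
    (mul_nonneg (h.levelWeight_nonneg hx hρ _ _ _) (growthTail_pos _ _ _ _).le)

lemma Rates.growthTail_le_potential (h : Rates lam θ) (hx : 0 ≤ x) (hρ : 0 ≤ ρ) (hC : C.Good θ)
    {j : ℕ} (hj : j < C.count) :
    growthTail lam x (C.tilt j) (C.size j) ≤ potential lam θ x ρ (C.level j) C := by
  have h1 := Finset.single_le_sum (s := Finset.range C.count) (fun i _ =>
    mul_nonneg (pathWeight_pos lam C i).le (mul_nonneg (h.levelWeight_nonneg hx hρ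
      (C.level j) (C.level i) (C.size i)) (growthTail_pos lam x (C.tilt i) (C.size i)).le))
    (Finset.mem_range.2 hj)
  refine le_trans ?_ h1
  have h2 : levelWeight lam θ x ρ (C.level j) (C.level j) (C.size j) = 1 := by
    simp [levelWeight]
  rw [h2, one_mul]
  exact le_mul_of_one_le_left (growthTail_pos _ _ _ _).le (h.one_le_pathWeight hC hj)

lemma Rates.potential_init_le (h : Rates lam θ) (hx : 0 ≤ x) (hρ : 0 ≤ ρ) {L : ℕ} (hL : 1 ≤ L) :
    potential lam θ x ρ L Config.init ≤ childTail lam θ x ρ 0 ^ L := by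
  have e1 : pathWeight lam Config.init 0 = 1 :=
    Finset.prod_eq_one fun q _ => tailProd_of_eq_zero (by simp [Config.init])
  have e2 : levelWeight lam θ x ρ L 0 1 = childTail lam θ x ρ 0 ^ L := by
    rw [levelWeight, if_pos (by omega), ← pow_succ]; congr 1; omega
  have e3 : growthTail lam x 0 1 ≤ 1 := tailProd_le_one fun s hs => h.growth_nonneg hx le_rfl hs
  unfold potential
  simp only [Config.init, Finset.sum_range_one, if_true] at e1 ⊢
  rw [e1, e2, one_mul]
  exact mul_le_of_le_one_right (pow_nonneg (h.childTail_nonneg hx hρ _) _) e3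

end GAM

namespace GAM

/-! ### The configurations along a realization of the model -/

/-- The configuration after `n` steps of the model driven by `b` and `t`. -/
noncomputable def config (θ : ℕ → ℝ) (b : ℕ → Bool) (t : ℕ → ℕ) : ℕ → Config
  | 0 => Config.init
  | n + 1 => if b n = true then (config θ b t n).birth θ (t n) else (config θ b t n).grow (t n)

section Realization

variable {lam θ : ℕ → ℝ} {b : ℕ → Bool} {t : ℕ → ℕ}

lemma config_count (θ : ℕ → ℝ) (b : ℕ → Bool) (t : ℕ → ℕ) (n : ℕ) :
    (config θ b t n).count = groupCount b n := by
  induction n with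
  | zero => rfl
  | succ n ih => simp only [config, groupCount]; split_ifs <;> simp [Config.birth, Config.grow, ih]

lemma config_size (θ : ℕ → ℝ) (b : ℕ → Bool) (t : ℕ → ℕ) (n : ℕ) :
    (config θ b t n).size = groupSize b t n := by
  induction n with
  | zero => rfl
  | succ n ih =>
    ext j
    simp only [config, groupSize]
    split_ifs with h1 h2 h2 <;>
      simp_all [Config.birth, Config.grow, config_count]

lemma config_good (h : Rates lam θ) {n : ℕ} (ht : ∀ i < n, t i < groupCount b i) :
    (config θ b t n).Good θ := by
  induction n with
  | zero => exact Config.good_init h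
  | succ n ih =>
    have hC := ih fun i hi => ht i (by omega)
    have hk : t n < (config θ b t n).count := by rw [config_count]; exact ht n (by omega)
    simp only [config]
    split_ifs
    · exact hC.birth h hk
    · exact hC.grow h hk

lemma config_congr {b' : ℕ → Bool} {t' : ℕ → ℕ} {n : ℕ}
    (h : ∀ i < n, b i = b' i ∧ t i = t' i) : config θ b t n = config θ b' t' n := by
  induction n with
  | zero => rfl
  | succ n ih =>
    simp only [config]
    rw [ih fun i hi => h i (by omega), (h n (by omega)).1, (h n (by omega)).2]

/-- Level and tilt of a group do not change after its birth. -/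
lemma config_stable {n m : ℕ} (hnm : n ≤ m) {j : ℕ} (hj : j < (config θ b t n).count) :
    j < (config θ b t m).count ∧ (config θ b t m).level j = (config θ b t n).level j ∧
      (config θ b t m).tilt j = (config θ b t n).tilt j := by
  induction m, hnm using Nat.le_induction with
  | base => exact ⟨hj, rfl, rfl⟩
  | succ m _ ih =>
    obtain ⟨h1, h2, h3⟩ := ih
    simp only [config]
    split_ifs
    · simp only [Config.birth, if_neg h1.ne]
      exact ⟨by omega, h2, h3⟩
    · exact ⟨h1, h2, h3⟩

lemma AtLevel.exists_config (ht : ∀ i, t i < groupCount b i) {j l : ℕ} (h : AtLevel b t j l) :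
    ∃ n, j < (config θ b t n).count ∧ (config θ b t n).level j = l := by
  induction h with
  | root => exact ⟨0, Nat.one_pos, rfl⟩
  | @child i l hb _ ih =>
    obtain ⟨n, hn, hl⟩ := ih
    have hti : t i < (config θ b t i).count := by rw [config_count]; exact ht i
    have e1 := (config_stable (le_max_left n i) hn).2.1
    have e2 := (config_stable (le_max_right n i) hti).2.1
    refine ⟨i + 1, ?_, ?_⟩
    · simp [config, hb, Config.birth, config_count]
    · simp only [config, hb, if_true, Config.birth, config_count]
      omega

end Realization

/-! ### Discounted potentials are supermartingales -/

section Measure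

/-- The mean holding time of the configuration `C`, if group `k` grows at rate
`(1 - p) * f (size k)` and the innovation probability is `σ`. -/
noncomputable def meanStep (f : ℕ → ℝ) (p σ : ℝ) (C : Config) : ℝ :=
  (1 - σ) / ((1 - p) * ∑ j ∈ Finset.range C.count, f (C.size j))

/-- The predictable clock: the sum of the mean holding times of the first `n` steps. -/
noncomputable def clock (f : ℕ → ℝ) (p : ℝ) (θ : ℕ → ℝ) (s : ℕ → ℝ) (b : ℕ → Bool) (t : ℕ → ℕ)
    (n : ℕ) : ℝ :=
  ∑ i ∈ Finset.range n, meanStep f p (s i) (config θ b t i)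

/-- One step of the model multiplies the expectation of `P` by at most `1 + x * δ`, where `δ` is
the mean holding time. Group `k` grows with probability `δ * lam (size k)` and has a child with
probability `β k ≤ δ * ρ * lam (size k)`. -/
def StepBound (lam θ : ℕ → ℝ) (ρ x : ℝ) (P : Config → ℝ) : Prop :=
  ∀ C : Config, C.Good θ → ∀ (δ : ℝ) (β : ℕ → ℝ), 0 ≤ δ →
    (∀ k < C.count, β k ≤ δ * (ρ * lam (C.size k))) →
    ∑ k ∈ Finset.range C.count, (δ * lam (C.size k) + β k) = 1 →
    ∑ k ∈ Finset.range C.count, (δ * lam (C.size k) * P (C.grow k) + β k * P (C.birth θ k)) ≤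
      (1 + x * δ) * P C

variable {Ω : Type*} {mΩ : MeasurableSpace Ω} {μ : Measure Ω}

lemma lintegral_indicator_eq_lintegral_mul {Ω : Type*} {m mΩ : MeasurableSpace Ω} {μ : Measure Ω}
    [IsFiniteMeasure μ] (hm : m ≤ mΩ) {E : Set Ω} (hE : MeasurableSet E) {q : Ω → ℝ}
    (hq : μ[E.indicator (fun _ => (1 : ℝ)) | m] =ᵐ[μ] q) {g : Ω → ENNReal}
    (hg : Measurable[m] g) :
    ∫⁻ ω, E.indicator g ω ∂μ = ∫⁻ ω, ENNReal.ofReal (q ω) * g ω ∂μ := by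
  set c := μ[E.indicator (fun _ => (1 : ℝ)) | m] with hc
  have hcm : Measurable c := (stronglyMeasurable_condExp.mono hm).measurable
  have hci : Integrable c μ := integrable_condExp
  have hE1 : Integrable (E.indicator fun _ => (1 : ℝ)) μ := (integrable_const _).indicator hE
  have hc0 : 0 ≤ᵐ[μ] c := condExp_nonneg
    (Eventually.of_forall fun ω => Set.indicator_nonneg (fun _ _ => zero_le_one) ω)
  have htrim : (μ.restrict E).trim hm = (μ.withDensity fun ω => ENNReal.ofReal (c ω)).trim hm := by
    refine @Measure.ext _ m _ _ fun A hA => ?_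
    rw [trim_measurableSet_eq hm hA, trim_measurableSet_eq hm hA, withDensity_apply _ (hm A hA),
      ← ofReal_integral_eq_lintegral_ofReal hci.restrict (ae_restrict_of_ae hc0),
      setIntegral_condExp hm hE1 hA, integral_indicator hE, Measure.restrict_restrict hE,
      Measure.restrict_apply (hm A hA), Set.inter_comm]
    simp [Measure.real]
  calc ∫⁻ ω, E.indicator g ω ∂μ = ∫⁻ ω, g ω ∂((μ.restrict E).trim hm) := by
        rw [lintegral_indicator hE, lintegral_trim hm hg]
    _ = ∫⁻ ω, ENNReal.ofReal (c ω) * g ω ∂μ := by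
        rw [htrim, lintegral_trim hm hg, lintegral_withDensity_eq_lintegral_mul _
          hcm.ennreal_ofReal (hg.mono hm le_rfl)]
        rfl
    _ = _ := lintegral_congr_ae (hq.mono fun ω h => by simp only [h])

variable {ℱ : Filtration ℕ mΩ} {f : ℕ → ℝ} {s : ℕ → Ω → ℝ} {b : ℕ → Ω → Bool} {t : ℕ → Ω → ℕ}

/-- The conditional probability of `b n = β` and `t n = k`, as a function of the configuration. -/
noncomputable def stepProb (f : ℕ → ℝ) (σ : ℝ) (C : Config) (β : Bool) (k : ℕ) : ℝ :=
  (if β = true then σ else 1 - σ) * (f (C.size k) / ∑ j ∈ Finset.range C.count, f (C.size j))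

lemma IsGAM.lintegral_step [IsFiniteMeasure μ] (hgam : IsGAM μ ℱ f s b t) (θ : ℕ → ℝ) (n : ℕ)
    {G : Bool × ℕ → Ω → ENNReal} (hG : ∀ e, Measurable[ℱ n] (G e)) :
    ∫⁻ ω, G (b n ω, t n ω) ω ∂μ = ∫⁻ ω, ∑' e : Bool × ℕ, ENNReal.ofReal
      (stepProb f (s n ω) (config θ (fun i => b i ω) (fun i => t i ω) n) e.1 e.2) * G e ω ∂μ := by
  have hb : Measurable (b n) := (hgam.measurable_b n).mono (ℱ.le _) le_rfl
  have ht : Measurable (t n) := (hgam.measurable_t n).mono (ℱ.le _) le_rfl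
  have hE : ∀ e : Bool × ℕ, MeasurableSet {ω | b n ω = e.1 ∧ t n ω = e.2} := fun e =>
    (hb (measurableSet_singleton e.1)).inter (ht (measurableSet_singleton e.2))
  have hGm : ∀ e, Measurable (G e) := fun e => (hG e).mono (ℱ.le _) le_rfl
  have key : ∀ e : Bool × ℕ, ∫⁻ ω, {ω | b n ω = e.1 ∧ t n ω = e.2}.indicator (G e) ω ∂μ =
      ∫⁻ ω, ENNReal.ofReal (stepProb f (s n ω)
        (config θ (fun i => b i ω) (fun i => t i ω) n) e.1 e.2) * G e ω ∂μ := fun e => by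
    refine lintegral_indicator_eq_lintegral_mul (ℱ.le n) (hE e) ?_ (hG e)
    refine (hgam.condProb n e.1 e.2).trans (Eventually.of_forall fun ω => ?_)
    simp only [stepProb, config_count, config_size]
  have hqm : ∀ e : Bool × ℕ, AEMeasurable (fun ω => ENNReal.ofReal (stepProb f (s n ω)
      (config θ (fun i => b i ω) (fun i => t i ω) n) e.1 e.2) * G e ω) μ := fun e => by
    have h1 : AEMeasurable (fun ω => stepProb f (s n ω)
        (config θ (fun i => b i ω) (fun i => t i ω) n) e.1 e.2) μ := by
      refine ((stronglyMeasurable_condExp.mono (ℱ.le n)).measurable.aemeasurable).congr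
        ((hgam.condProb n e.1 e.2).trans (Eventually.of_forall fun ω => ?_))
      simp only [stepProb, config_count, config_size]
    exact h1.ennreal_ofReal.mul (hGm e).aemeasurable
  rw [lintegral_tsum hqm]
  simp_rw [← key]
  rw [← lintegral_tsum fun e => ((hGm e).indicator (hE e)).aemeasurable]
  refine lintegral_congr fun ω => ?_
  rw [tsum_eq_single (b n ω, t n ω) fun e he => Set.indicator_of_notMem (fun h => he ?_) _]
  · rw [Set.indicator_of_mem (by simp)]
  · exact Prod.ext h.1.symm h.2.symm

/-- The configuration after `n` steps depends only on the first `n` values of `b` and `t`, which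
range over a countable set, so that every function of it is measurable. -/
lemma IsGAM.measurable_config (hgam : IsGAM μ ℱ f s b t) (θ : ℕ → ℝ) (n : ℕ) {β : Type*}
    [MeasurableSpace β] (g : Config → β) :
    Measurable[ℱ n] fun ω => g (config θ (fun i => b i ω) (fun i => t i ω) n) := by
  set F : (Fin n → Bool × ℕ) → β := fun H =>
    g (config θ (fun i => if h : i < n then (H ⟨i, h⟩).1 else true)
      (fun i => if h : i < n then (H ⟨i, h⟩).2 else 0) n) with hF
  have h1 : Measurable[ℱ n] fun ω => (fun i : Fin n => (b i ω, t i ω)) := by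
    refine @measurable_pi_lambda _ _ _ (ℱ n) _ _ fun i => ?_
    exact ((hgam.measurable_b i).mono (ℱ.mono (by omega)) le_rfl).prodMk
      ((hgam.measurable_t i).mono (ℱ.mono (by omega)) le_rfl)
  have h2 : (fun ω => g (config θ (fun i => b i ω) (fun i => t i ω) n)) =
      fun ω => F fun i : Fin n => (b i ω, t i ω) := by
    ext ω
    rw [hF]
    congr 1
    exact config_congr fun i hi => by simp [hi]
  rw [h2]
  exact (measurable_of_countable F).comp h1

/-- The clock is predictable: the mean holding time of step `n` is known before that step. -/
lemma IsGAM.measurable_clock (hgam : IsGAM μ ℱ f s b t) (p : ℝ) (θ : ℕ → ℝ) (n : ℕ) :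
    Measurable[ℱ n] fun ω => clock f p θ (fun i => s i ω) (fun i => b i ω) (fun i => t i ω)
      (n + 1) := by
  refine @Finset.measurable_fun_sum _ _ _ _ _ _ (ℱ n) _ (Finset.range (n + 1)) fun i hi => ?_
  have hi' : i ≤ n := Nat.lt_succ_iff.1 (Finset.mem_range.1 hi)
  have h1 : Measurable[ℱ n] (s i) := (hgam.measurable_s i).mono (ℱ.mono hi') le_rfl
  have h2 := (hgam.measurable_config θ i fun C : Config =>
    (1 - p) * ∑ j ∈ Finset.range C.count, f (C.size j)).mono (ℱ.mono hi') le_rfl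
  exact (measurable_const.sub h1).div h2

/-- Almost surely, every `t n` is a group that exists at that time. -/
lemma IsGAM.ae_lt_groupCount [IsFiniteMeasure μ] (hgam : IsGAM μ ℱ f s b t) (hf0 : f 0 = 0)
    {lam θ : ℕ → ℝ} (h : Rates lam θ) :
    ∀ᵐ ω ∂μ, ∀ i, t i ω < groupCount (fun i => b i ω) i := by
  have key : ∀ n, ∀ᵐ ω ∂μ, ∀ i < n, t i ω < groupCount (fun i => b i ω) i := by
    intro n
    induction n with
    | zero => simp
    | succ n ih =>
      have hm : ∀ e : Bool × ℕ, Measurable[ℱ n] fun ω =>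
          if (config θ (fun i => b i ω) (fun i => t i ω) n).count ≤ e.2 then (1 : ENNReal)
            else 0 := fun e =>
        hgam.measurable_config θ n fun C : Config => if C.count ≤ e.2 then (1 : ENNReal) else 0
      have hstep := hgam.lintegral_step θ n hm
      have hzero := hstep.trans ((lintegral_congr_ae (g := fun _ => 0)
        (ih.mono fun ω hω => ?_)).trans lintegral_zero)
      · rw [lintegral_eq_zero_iff' ?_] at hzero
        · filter_upwards [ih, hzero] with ω h1 h2 i hi
          rcases Nat.lt_succ_iff_lt_or_eq.1 hi with h3 | rfl
          · exact h1 i h3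
          · by_contra hcon
            rw [config_count] at h2
            simp [if_pos (not_lt.1 hcon)] at h2
        · have ht : Measurable (t n) := (hgam.measurable_t n).mono (ℱ.le _) le_rfl
          have hc := (hgam.measurable_config θ n Config.count).mono (ℱ.le n) le_rfl
          exact (Measurable.ite (measurableSet_le hc ht) measurable_const
            measurable_const).aemeasurable
      · have hC := config_good (θ := θ) h hω
        simp only [ENNReal.tsum_eq_zero]
        intro e
        split_ifs with he
        · simp [stepProb, hC.size_zero e.2 he, hf0]
        · simp
  filter_upwards [ae_all_iff.2 key] with ω hω i using hω (i + 1) i (Nat.lt_succ_self i)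

lemma meanStep_nonneg {p σ : ℝ} {θ : ℕ → ℝ} {C : Config} (hf : ∀ i, 1 ≤ i → 0 < f i)
    (hp : p < 1) (hσ : σ ≤ p) (hC : C.Good θ) : 0 ≤ meanStep f p σ C := by
  refine div_nonneg (by linarith) (mul_nonneg (by linarith) (Finset.sum_nonneg fun j hj => ?_))
  exact (hf _ (hC.size_pos j (Finset.mem_range.1 hj))).le

/-- The transition probabilities of the model satisfy the assumptions of `StepBound`. -/
lemma StepBound.sum_stepProb_le {p x σ : ℝ} {θ : ℕ → ℝ} {P : Config → ℝ}
    (hP : StepBound (fun i => (1 - p) * f i) θ (p / (1 - p)) x P)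
    (hf : ∀ i, 1 ≤ i → 0 < f i) (hp : p < 1) (hσ : σ ≤ p) {C : Config} (hC : C.Good θ) :
    ∑ k ∈ Finset.range C.count, (stepProb f σ C false k * P (C.grow k) +
      stepProb f σ C true k * P (C.birth θ k)) ≤ (1 + x * meanStep f p σ C) * P C := by
  set F := ∑ j ∈ Finset.range C.count, f (C.size j) with hF
  have hfk : ∀ k < C.count, 0 < f (C.size k) := fun k hk => hf _ (hC.size_pos k hk)
  have hFpos : 0 < F := Finset.sum_pos (fun j hj => hfk j (Finset.mem_range.1 hj))
    ⟨0, Finset.mem_range.2 hC.count_pos⟩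
  have h1p : 0 < 1 - p := by linarith
  have e0 : ∀ k, meanStep f p σ C * ((1 - p) * f (C.size k)) = stepProb f σ C false k := by
    intro k
    simp only [meanStep, stepProb, ← hF]
    simp only [Bool.false_eq_true, if_false]
    field_simp
  have := hP C hC (meanStep f p σ C) (stepProb f σ C true) (meanStep_nonneg hf hp hσ hC)
    (fun k hk => ?_) ?_
  · simpa only [e0] using this
  · have hfk' := hfk k hk
    simp only [meanStep, stepProb, ← hF, if_true]
    have : (1 - σ) / ((1 - p) * F) * (p / (1 - p) * ((1 - p) * f (C.size k))) =
        (p * (1 - σ) / (1 - p)) * (f (C.size k) / F) := by field_simp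
    rw [this]
    refine mul_le_mul_of_nonneg_right ?_ (by positivity)
    rw [le_div_iff₀ h1p]
    nlinarith
  · simp only [e0]
    simp only [stepProb, ← hF, if_true, Bool.false_eq_true, if_false, ← add_mul]
    rw [← Finset.mul_sum, ← Finset.sum_div, ← hF, div_self hFpos.ne']
    ring

/-- The expectation of a potential with `StepBound`, discounted by the clock, is at most its
initial value. -/
theorem IsGAM.lintegral_exp_clock_le [IsProbabilityMeasure μ] (hgam : IsGAM μ ℱ f s b t)
    {p x : ℝ} {θ : ℕ → ℝ} (hf0 : f 0 = 0) (hf : ∀ i, 1 ≤ i → 0 < f i) (hp : p < 1)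
    (hs : ∀ n ω, s n ω ≤ p) (h : Rates (fun i => (1 - p) * f i) θ) {P : Config → ℝ}
    (hP0 : ∀ C, 0 ≤ P C) (hP : StepBound (fun i => (1 - p) * f i) θ (p / (1 - p)) x P) (n : ℕ) :
    ∫⁻ ω, ENNReal.ofReal (Real.exp (-x * clock f p θ (fun i => s i ω) (fun i => b i ω)
        (fun i => t i ω) n) * P (config θ (fun i => b i ω) (fun i => t i ω) n)) ∂μ ≤
      ENNReal.ofReal (P Config.init) := by
  induction n with
  | zero => simp [clock, config]
  | succ n ih =>
    refine le_trans ?_ ih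
    set C : Ω → Config := fun ω => config θ (fun i => b i ω) (fun i => t i ω) n with hCdef
    set T : ℕ → Ω → ℝ := fun n ω => clock f p θ (fun i => s i ω) (fun i => b i ω)
      (fun i => t i ω) n with hT
    set G : Bool × ℕ → Ω → ENNReal := fun e ω => ENNReal.ofReal (Real.exp (-x * T (n + 1) ω) *
      P (if e.1 = true then (C ω).birth θ e.2 else (C ω).grow e.2)) with hG
    have hGm : ∀ e, Measurable[ℱ n] (G e) := fun e =>
      (((hgam.measurable_clock p θ n).const_mul (-x)).exp.mul (hgam.measurable_config θ n
        fun C : Config => P (if e.1 = true then C.birth θ e.2 else C.grow e.2))).ennreal_ofReal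
    have hstep := hgam.lintegral_step θ n hGm
    calc _ = ∫⁻ ω, G (b n ω, t n ω) ω ∂μ := rfl
      _ = _ := hstep
      _ ≤ _ := by
        refine lintegral_mono_ae ?_
        filter_upwards [hgam.ae_lt_groupCount hf0 h] with ω hω
        have hC : (C ω).Good θ := config_good h fun i _ => hω i
        have hprob : ∀ β k, 0 ≤ stepProb f (s n ω) (C ω) β k := fun β k => by
          have h01 := hgam.s_mem n ω
          have hf' : ∀ i, 0 ≤ f i := fun i => by
            rcases Nat.eq_zero_or_pos i with rfl | hi
            exacts [hf0.ge, (hf i hi).le]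
          refine mul_nonneg ?_ (div_nonneg (hf' _) (Finset.sum_nonneg fun _ _ => hf' _))
          split_ifs <;> linarith [h01.1, h01.2]
        have hzero : ∀ β k, k ∉ Finset.range (C ω).count → stepProb f (s n ω) (C ω) β k = 0 :=
          fun β k hk => by
            simp [stepProb, hC.size_zero k (by simpa using hk), hf0]
        have hE := Real.exp_pos (-x * T (n + 1) ω)
        calc ∑' e : Bool × ℕ, ENNReal.ofReal (stepProb f (s n ω) (C ω) e.1 e.2) * G e ω
            = ∑ k ∈ Finset.range (C ω).count, ENNReal.ofReal (Real.exp (-x * T (n + 1) ω) *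
              (stepProb f (s n ω) (C ω) false k * P ((C ω).grow k) +
                stepProb f (s n ω) (C ω) true k * P ((C ω).birth θ k))) := by
              rw [ENNReal.tsum_prod', tsum_fintype, Fintype.sum_bool,
                tsum_eq_sum (s := Finset.range (C ω).count) fun k hk => by simp [hzero true k hk],
                tsum_eq_sum (s := Finset.range (C ω).count) fun k hk => by simp [hzero false k hk],
                ← Finset.sum_add_distrib]
              refine Finset.sum_congr rfl fun k _ => ?_
              have p1 := hprob true k
              have p2 := hprob false k
              have p3 := hP0 ((C ω).grow k)
              have p4 := hP0 ((C ω).birth θ k)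
              simp only [hG, if_true, Bool.false_eq_true, if_false]
              rw [← ENNReal.ofReal_mul p1, ← ENNReal.ofReal_mul p2,
                ← ENNReal.ofReal_add (by positivity) (by positivity)]
              congr 1; ring
          _ = ENNReal.ofReal (Real.exp (-x * T (n + 1) ω) * ∑ k ∈ Finset.range (C ω).count,
              (stepProb f (s n ω) (C ω) false k * P ((C ω).grow k) +
                stepProb f (s n ω) (C ω) true k * P ((C ω).birth θ k))) := by
              rw [Finset.mul_sum, ENNReal.ofReal_sum_of_nonneg fun k _ => ?_]
              exact mul_nonneg hE.le (add_nonneg (mul_nonneg (hprob _ _) (hP0 _))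
                (mul_nonneg (hprob _ _) (hP0 _)))
          _ ≤ ENNReal.ofReal (Real.exp (-x * T n ω) * P (C ω)) := by
              refine ENNReal.ofReal_le_ofReal ?_
              have h1 := hP.sum_stepProb_le hf hp (hs n ω) hC
              have h2 : T (n + 1) ω = T n ω + meanStep f p (s n ω) (C ω) :=
                Finset.sum_range_succ _ _
              generalize meanStep f p (s n ω) (C ω) = δ at *
              -- `1 + x * δ ≤ exp (x * δ)` for both signs of `x`, so that the deterministic
              -- holding time `δ` can stand in for an exponential one with this mean.
              calc _ ≤ Real.exp (-x * T (n + 1) ω) * (Real.exp (x * δ) * P (C ω)) := by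
                    refine mul_le_mul_of_nonneg_left (h1.trans ?_) hE.le
                    refine mul_le_mul_of_nonneg_right ?_ (hP0 _)
                    linarith [Real.add_one_le_exp (x * δ)]
                _ = _ := by rw [← mul_assoc, ← Real.exp_add, h2]; ring_nf

/-- A Markov inequality for the limit inferior of the discounted potential. -/
theorem IsGAM.measure_le_of_eventually [IsProbabilityMeasure μ] (hgam : IsGAM μ ℱ f s b t)
    {p x : ℝ} {θ : ℕ → ℝ} (hf0 : f 0 = 0) (hf : ∀ i, 1 ≤ i → 0 < f i) (hp : p < 1)
    (hs : ∀ n ω, s n ω ≤ p) (h : Rates (fun i => (1 - p) * f i) θ) {P : Config → ℝ}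
    (hP0 : ∀ C, 0 ≤ P C) (hP : StepBound (fun i => (1 - p) * f i) θ (p / (1 - p)) x P)
    {E : Set Ω} {c : ℝ} (hc : 0 < c)
    (hE : ∀ᵐ ω ∂μ, ω ∈ E → ∀ c' < c, ∀ᶠ n in atTop,
      c' ≤ Real.exp (-x * clock f p θ (fun i => s i ω) (fun i => b i ω) (fun i => t i ω) n) *
        P (config θ (fun i => b i ω) (fun i => t i ω) n)) :
    μ E ≤ ENNReal.ofReal (P Config.init / c) := by
  set Y : ℕ → Ω → ENNReal := fun n ω => ENNReal.ofReal (Real.exp (-x * clock f p θ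
    (fun i => s i ω) (fun i => b i ω) (fun i => t i ω) n) *
      P (config θ (fun i => b i ω) (fun i => t i ω) n)) with hY
  have hclock : ∀ n, Measurable fun ω => clock f p θ (fun i => s i ω) (fun i => b i ω)
      (fun i => t i ω) n := fun n => by
    cases n with
    | zero => simp [clock]
    | succ n => exact (hgam.measurable_clock p θ n).mono (ℱ.le n) le_rfl
  have hYm : ∀ n, Measurable (Y n) := fun n =>
    (((hclock n).const_mul (-x)).exp.mul
      ((hgam.measurable_config θ n P).mono (ℱ.le n) le_rfl)).ennreal_ofReal
  have hlim : ∫⁻ ω, liminf (fun n => Y n ω) atTop ∂μ ≤ ENNReal.ofReal (P Config.init) := by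
    refine (lintegral_liminf_le hYm).trans ?_
    refine (liminf_le_liminf (v := fun _ => ENNReal.ofReal (P Config.init))
      (Eventually.of_forall fun n => hgam.lintegral_exp_clock_le hf0 hf hp hs h hP0 hP n)).trans ?_
    simp
  have hsub : μ E ≤ μ {ω | ENNReal.ofReal c ≤ liminf (fun n => Y n ω) atTop} := by
    refine measure_mono_ae (hE.mono fun ω hω hωE => ?_)
    refine le_of_forall_lt fun a ha => ?_
    obtain ⟨a', h1, h2⟩ := exists_between ha
    have h2' : a'.toReal < c := ENNReal.toReal_lt_of_lt_ofReal h2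
    refine h1.trans_le (le_liminf_of_le (by isBoundedDefault) ?_)
    filter_upwards [hω hωE _ h2'] with n hn
    rw [← ENNReal.ofReal_toReal h2.ne_top]
    exact ENNReal.ofReal_le_ofReal hn
  refine hsub.trans ((meas_ge_le_lintegral_div (Measurable.liminf hYm).aemeasurable
    (by simpa using hc) ENNReal.ofReal_ne_top).trans ?_)
  rw [ENNReal.ofReal_div_of_pos hc]
  gcongr

end Measure

end GAM

namespace GAM

/-! ### The explicit constants -/

section Constants

variable {f : ℕ → ℝ} {p x : ℝ}

lemma theta_eq_sqrt_inv (f : ℕ → ℝ) (p : ℝ) (k : ℕ) :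
    theta f p k = Real.sqrt (∑' i : ℕ, 2 / ((1 - p) ^ 2 * f (k + 1 + i) ^ 2))⁻¹ := by
  rw [theta, one_div]

lemma summable_theta_series (hf : ∀ i, 1 ≤ i → 0 < f i)
    (hsum : Summable fun n : ℕ => 1 / f (n + 1)) (p : ℝ) (k : ℕ) :
    Summable fun i => 2 / ((1 - p) ^ 2 * f (k + 1 + i) ^ 2) := by
  have hpos : ∀ n, 0 < f (n + 1) := fun n => hf _ (by omega)
  have h1 : Summable fun n : ℕ => (1 / f (n + 1)) ^ 2 := by
    refine Summable.of_nonneg_of_le (fun n => sq_nonneg _) (fun n => ?_)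
      (hsum.mul_left (∑' n : ℕ, 1 / f (n + 1)))
    have h0 : 0 ≤ 1 / f (n + 1) := (one_div_pos.2 (hpos n)).le
    rw [sq]
    exact mul_le_mul_of_nonneg_right
      (hsum.le_tsum n fun m _ => (one_div_pos.2 (hpos m)).le) h0
  refine ((summable_comp_add h1 k).mul_left (2 / (1 - p) ^ 2)).congr fun i => ?_
  rw [show k + i + 1 = k + 1 + i by omega, one_div, inv_pow, div_mul_eq_div_div, div_eq_mul_inv _
    (f (k + 1 + i) ^ 2)]

lemma rates_theta (hf : ∀ i, 1 ≤ i → 0 < f i) (hp : p < 1)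
    (hsum : Summable fun n : ℕ => 1 / f (n + 1)) :
    Rates (fun i => (1 - p) * f i) (theta f p) := by
  have h1p : 0 < 1 - p := by linarith
  have hs := summable_theta_series hf hsum p
  have hterm : ∀ k i, 0 < 2 / ((1 - p) ^ 2 * f (k + 1 + i) ^ 2) := fun k i => by
    have := hf (k + 1 + i) (by omega)
    positivity
  have hS : ∀ k, 0 < ∑' i : ℕ, 2 / ((1 - p) ^ 2 * f (k + 1 + i) ^ 2) := fun k =>
    (hs k).tsum_pos (fun i => (hterm k i).le) 0 (hterm k 0)
  refine ⟨fun s hs => mul_pos h1p (hf s hs), ?_, fun κ => Real.sqrt_nonneg _, ?_, fun κ => ?_⟩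
  · rw [← summable_nat_add_iff 1]
    refine (hsum.mul_left (1 - p)⁻¹).congr fun n => ?_
    rw [mul_inv, one_div]
  · refine monotone_nat_of_le_succ fun k => ?_
    rw [theta_eq_sqrt_inv, theta_eq_sqrt_inv]
    refine Real.sqrt_le_sqrt (inv_anti₀ (hS _) ?_)
    rw [(hs k).tsum_eq_zero_add]
    have e : ∑' i, 2 / ((1 - p) ^ 2 * f (k + 1 + (i + 1)) ^ 2) =
        ∑' i, 2 / ((1 - p) ^ 2 * f (k + 1 + 1 + i) ^ 2) :=
      tsum_congr fun i => by rw [show k + 1 + (i + 1) = k + 1 + 1 + i by omega]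
    rw [e]
    linarith [hterm k 0]
  · have h1 := (hs κ).hasSum.mul_left (theta f p κ ^ 2 / 2)
    have h2 : theta f p κ ^ 2 / 2 * ∑' i : ℕ, 2 / ((1 - p) ^ 2 * f (κ + 1 + i) ^ 2) = 1 / 2 := by
      have := hS κ
      rw [theta_eq_sqrt_inv, Real.sq_sqrt (inv_nonneg.2 this.le)]
      field_simp
    have e : (fun i => (theta f p κ / ((1 - p) * f (κ + 1 + i))) ^ 2) = fun i =>
        theta f p κ ^ 2 / 2 * (2 / ((1 - p) ^ 2 * f (κ + 1 + i) ^ 2)) := by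
      funext i
      have := hf (κ + 1 + i) (by omega)
      field_simp
    rw [h2, ← e] at h1
    exact h1

lemma discWeight_eq (f : ℕ → ℝ) (p x : ℝ) (k : ℕ) :
    discWeight (fun i => (1 - p) * f i) (theta f p) x k = weight f p k *
      ((f 1 * (1 - p) + theta f p k) / (f 1 * (1 - p) + theta f p k + x)) := by
  simp only [discWeight, weight, mul_comm (1 - p)]

lemma weight_pos (hf : ∀ i, 1 ≤ i → 0 < f i) (hp : p < 1) (k : ℕ) : 0 < weight f p k := by
  have h1p : 0 < 1 - p := by linarith
  refine Finset.prod_pos fun s hs => ?_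
  have h1 := hf s (Finset.mem_Icc.1 hs).1
  have h2 : 0 ≤ theta f p k := Real.sqrt_nonneg _
  positivity

lemma ratio_le_one (hf : ∀ i, 1 ≤ i → 0 < f i) (hp : p < 1) (hx : 0 ≤ x) (k : ℕ) :
    0 < (f 1 * (1 - p) + theta f p k) / (f 1 * (1 - p) + theta f p k + x) ∧
    (f 1 * (1 - p) + theta f p k) / (f 1 * (1 - p) + theta f p k + x) ≤ 1 := by
  have h1 : 0 < f 1 * (1 - p) := mul_pos (hf 1 le_rfl) (by linarith)
  have h2 : 0 ≤ theta f p k := Real.sqrt_nonneg _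
  refine ⟨by positivity, ?_⟩
  rw [div_le_one (by positivity)]
  linarith

lemma summable_discWeight (hf : ∀ i, 1 ≤ i → 0 < f i) (hp : p < 1) (hx : 0 ≤ x)
    (hw : Summable (weight f p)) :
    Summable (discWeight (fun i => (1 - p) * f i) (theta f p) x) := by
  refine Summable.of_nonneg_of_le (fun k => ?_) (fun k => ?_) hw <;> rw [discWeight_eq] <;>
    have h1 := weight_pos hf hp k <;> have h2 := ratio_le_one hf hp hx k
  · exact mul_nonneg h1.le h2.1.le
  · exact mul_le_of_le_one_right h1.le h2.2

lemma Phi_pos (hf : ∀ i, 1 ≤ i → 0 < f i) (hp : p < 1) (hx : 0 ≤ x)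
    (hw : Summable (weight f p)) : 0 < Phi f p x := by
  have hd := summable_discWeight hf hp hx hw
  simp only [funext (discWeight_eq f p x)] at hd
  have hpos : ∀ k, 0 < weight f p k *
      ((f 1 * (1 - p) + theta f p k) / (f 1 * (1 - p) + theta f p k + x)) := fun k =>
    mul_pos (weight_pos hf hp k) (ratio_le_one hf hp hx k).1
  exact mul_pos (div_pos (by norm_num) (by linarith))
    (hd.tsum_pos (fun k => (hpos k).le) 0 (hpos 0))

lemma mConst_pos (hf : ∀ i, 1 ≤ i → 0 < f i) (hp : p < 1) (hw : Summable (weight f p)) :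
    0 < mConst f p :=
  mul_pos (div_pos (by norm_num) (by linarith))
    (hw.tsum_pos (fun k => (weight_pos hf hp k).le) 0 (weight_pos hf hp 0))

lemma minRate_le (hf : ∀ i, 1 ≤ i → 0 < f i) {i : ℕ} (hi : 1 ≤ i) : minRate f ≤ f i := by
  obtain ⟨k, rfl⟩ := Nat.exists_eq_add_of_le' hi
  exact ciInf_le ⟨0, by rintro _ ⟨k, rfl⟩; exact (hf _ (by omega)).le⟩ k

lemma minRate_pos (hf : ∀ i, 1 ≤ i → 0 < f i) (hsum : Summable fun n : ℕ => 1 / f (n + 1)) :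
    0 < minRate f := by
  have hpos : ∀ n, 0 < 1 / f (n + 1) := fun n => one_div_pos.2 (hf _ (by omega))
  have hB := hsum.tsum_pos (fun n => (hpos n).le) 0 (hpos 0)
  refine (one_div_pos.2 hB).trans_le (le_ciInf fun k => ?_)
  have h1 := hsum.le_tsum k fun m _ => (hpos m).le
  rw [one_div_le hB (hf _ (by omega))]
  exact h1

lemma childTail_zero_eq (hp : p < 1) :
    childTail (fun i => (1 - p) * f i) (theta f p) x (p / (1 - p)) 0 =
      Real.exp 1 * p / 4 * Phi f p x := by
  have h1p : 1 - p ≠ 0 := by linarith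
  simp only [childTail, Phi, zero_add, discWeight_eq]
  field_simp

lemma tendsto_Phi (hf : ∀ i, 1 ≤ i → 0 < f i) (hp : p < 1) (hw : Summable (weight f p)) :
    Tendsto (Phi f p) atTop (𝓝 0) := by
  have h : Tendsto (fun x => ∑' k : ℕ, weight f p k *
      ((f 1 * (1 - p) + theta f p k) / (f 1 * (1 - p) + theta f p k + x))) atTop
      (𝓝 (∑' _ : ℕ, (0 : ℝ))) := by
    refine tendsto_tsum_of_dominated_convergence hw (fun k => ?_) ?_
    · have := ((tendsto_const_nhds (x := f 1 * (1 - p) + theta f p k)).div_atTop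
        (tendsto_atTop_add_const_left _ (f 1 * (1 - p) + theta f p k) tendsto_id)).const_mul
        (weight f p k)
      simpa using this
    · filter_upwards [eventually_ge_atTop 0] with x hx k
      have h1 := weight_pos hf hp k
      have h2 := ratio_le_one hf hp hx k
      rw [Real.norm_of_nonneg (mul_nonneg h1.le h2.1.le)]
      exact mul_le_of_le_one_right h1.le h2.2
  have h2 := h.const_mul (4 / (1 - p))
  rw [tsum_zero, mul_zero] at h2
  exact h2

lemma tendsto_rate (hf : ∀ i, 1 ≤ i → 0 < f i) (hp : p < 1) (hw : Summable (weight f p)) {M : ℝ}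
    (hM : 0 < M) : Tendsto (fun n : ℕ => rate f p n M) atTop atTop := by
  have h1 : Tendsto (fun n : ℕ => (n : ℝ) / M) atTop atTop :=
    tendsto_natCast_atTop_atTop.atTop_div_const hM
  have h2 : Tendsto (fun n : ℕ => Phi f p (n / M)) atTop (𝓝[>] 0) :=
    tendsto_nhdsWithin_iff.2 ⟨(tendsto_Phi hf hp hw).comp h1,
      Eventually.of_forall fun n => Phi_pos hf hp (by positivity) hw⟩
  have h3 := (tendsto_inv_nhdsGT_zero.comp h2).const_mul_atTop (mConst_pos hf hp hw)
  exact tendsto_atTop_add_const_right _ (-1) (Real.tendsto_log_atTop.comp h3)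

lemma mConst_pow_mul_exp_rate (hf : ∀ i, 1 ≤ i → 0 < f i) (hp : p < 1)
    (hw : Summable (weight f p)) {M : ℝ} (hM : 0 < M) (n : ℕ) :
    mConst f p ^ n * Real.exp (-(rate f p n M * n)) = (Real.exp 1 * Phi f p (n / M)) ^ n := by
  have h1 := mConst_pos hf hp hw
  have h2 : 0 < Phi f p (n / M) := Phi_pos hf hp (by positivity) hw
  rw [show -(rate f p n M * n) = n * (-rate f p n M) by ring, Real.exp_nat_mul, ← mul_pow]
  congr 1
  rw [rate, neg_sub, sub_eq_add_neg, Real.exp_add, Real.exp_neg, Real.exp_log (div_pos h1 h2)]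
  field_simp

end Constants

/-! ### The two parts of the tail bound -/

section Tail

variable {Ω : Type*} {mΩ : MeasurableSpace Ω} {μ : Measure Ω} {ℱ : Filtration ℕ mΩ}
  {f : ℕ → ℝ} {s : ℕ → Ω → ℝ} {b : ℕ → Ω → Bool} {t : ℕ → Ω → ℕ} {p : ℝ}

lemma clock_mono {θ : ℕ → ℝ} (hf : ∀ i, 1 ≤ i → 0 < f i) (hp : p < 1)
    (h : Rates (fun i => (1 - p) * f i) θ) {s : ℕ → ℝ} (hs : ∀ n, s n ≤ p) {b : ℕ → Bool}
    {t : ℕ → ℕ} (ht : ∀ i, t i < groupCount b i) : Monotone (clock f p θ s b t) := by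
  refine monotone_nat_of_le_succ fun n => ?_
  rw [clock, clock, Finset.sum_range_succ]
  exact le_add_of_nonneg_right (meanStep_nonneg hf hp (hs n) (config_good h fun i _ => ht i))

/-- The growth of the root, discounted at the negative rate `-c`. -/
lemma stepBound_root {lam θ : ℕ → ℝ} (h : Rates lam θ) {ρ c : ℝ}
    (hc : ∀ i, 1 ≤ i → c < lam i) :
    StepBound lam θ ρ (-c) fun C => tailProd (fun i => -c / lam i) (C.size 0) := by
  intro C hC δ β _ _ hone
  have h0 : 0 ∈ Finset.range C.count := by simpa using hC.count_pos
  have hA := hC.size_pos 0 hC.count_pos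
  have hl := h.pos _ hA
  have hsucc := tailProd_succ (h.summable_div (-c)) (A := C.size 0) (by
    have : c / lam (C.size 0) < 1 := (div_lt_one hl).2 (hc _ hA)
    rw [neg_div]; linarith)
  set W := tailProd (fun i => -c / lam i) (C.size 0) with hW
  have e : ∀ k ∈ Finset.range C.count,
      δ * lam (C.size k) * tailProd (fun i => -c / lam i) ((C.grow k).size 0) +
        β k * tailProd (fun i => -c / lam i) ((C.birth θ k).size 0) =
      (δ * lam (C.size k) + β k) * W + if k = 0 then -c * δ * W else 0 := by
    intro k _
    simp only [Config.grow, Config.birth, if_neg hC.count_pos.ne]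
    split_ifs with hk
    · subst hk
      rw [hsucc, ← hW]
      field_simp
      ring
    · rw [add_zero, ← hW]; ring
  rw [Finset.sum_congr rfl e, Finset.sum_add_distrib, ← Finset.sum_mul, hone, Finset.sum_ite_eq',
    if_pos h0]
  linarith

/-- The clock exceeds `M` with probability at most `C₁ * exp (-M * C₂)`, by the
exponential moment of the time in which the root grows to infinity. -/
lemma IsGAM.measure_clock_gt_le [IsProbabilityMeasure μ] (hgam : IsGAM μ ℱ f s b t)
    (hf0 : f 0 = 0) (hf : ∀ i, 1 ≤ i → 0 < f i) (hp : p < 1) (hs : ∀ n ω, s n ω ≤ p)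
    (hsum : Summable fun n : ℕ => 1 / f (n + 1)) (M : ℝ) :
    μ {ω | ∃ n, M < clock f p (theta f p) (fun i => s i ω) (fun i => b i ω) (fun i => t i ω) n} ≤
      ENNReal.ofReal (C₁ f * Real.exp (-(M * C₂ f p))) := by
  have h := rates_theta hf hp hsum
  have ha := minRate_pos hf hsum
  have h1p : 0 < 1 - p := by linarith
  have hc0 : 0 < C₂ f p := by unfold C₂; positivity
  have hc2 : ∀ i, 1 ≤ i → C₂ f p / ((1 - p) * f i) ≤ 1 / 2 := fun i hi => by
    have := minRate_le hf hi
    have := hf i hi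
    rw [C₂, div_le_iff₀ (by positivity)]
    nlinarith
  have hc : ∀ i, 1 ≤ i → C₂ f p < (1 - p) * f i := fun i hi => by
    have := mul_pos h1p (hf i hi)
    have h2 := hc2 i hi
    rw [div_le_iff₀ this] at h2
    linarith
  have hone : ∀ A, 1 ≤ A → 1 ≤ tailProd (fun i => -C₂ f p / ((1 - p) * f i)) A := fun A hA => by
    refine one_le_tailProd (fun i hi => ?_) fun i hi => ?_
    · exact div_nonpos_of_nonpos_of_nonneg (by linarith) (h.pos i (hA.trans hi)).le
    · rw [neg_div]; linarith [hc2 i (hA.trans hi)]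
  have hinit : tailProd (fun i => -C₂ f p / ((1 - p) * f i)) 1 ≤ C₁ f := by
    have h1 := tailProd_neg_le_exp (h.summable_div (C₂ f p)) (A := 1)
      (fun i hi => div_nonneg hc0.le (h.pos i hi).le) hc2
    simp only [neg_div]
    refine h1.trans_eq ?_
    rw [C₁, ← tsum_mul_left, ← tsum_mul_left]
    congr 2; ext i
    have := hf (i + 1) (by omega)
    rw [C₂, add_comm 1 i]
    field_simp
  refine (hgam.measure_le_of_eventually hf0 hf hp hs h (fun C => (tailProd_pos _ (C.size 0)).le)
    (stepBound_root h hc) (c := Real.exp (M * C₂ f p)) (Real.exp_pos _) ?_).trans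
    (ENNReal.ofReal_le_ofReal ?_)
  · filter_upwards [hgam.ae_lt_groupCount hf0 h] with ω hω
    rintro ⟨n, hn⟩ c' hc'
    filter_upwards [eventually_ge_atTop n] with m hm
    have h1 := clock_mono hf hp h (fun i => hs i ω) hω hm
    have hC := config_good (n := m) h fun i _ => hω i
    have h2 := hone _ (hC.size_pos 0 hC.count_pos)
    refine hc'.le.trans (le_trans ?_ (le_mul_of_one_le_right (Real.exp_pos _).le h2))
    rw [Real.exp_le_exp]
    nlinarith
  · rw [Real.exp_neg, ← div_eq_mul_inv]
    gcongr
    exact hinit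

lemma stepBound_potential {lam θ : ℕ → ℝ} (h : Rates lam θ) {x ρ : ℝ}
    (hw : Summable (discWeight lam θ x)) (hx : 0 ≤ x) (hρ : 0 ≤ ρ) (L : ℕ) :
    StepBound lam θ ρ x (potential lam θ x ρ L) :=
  fun _ hC _ _ hδ hβ hone => h.potential_step_le hw hx hρ hC L hδ hβ hone

/-- The first-moment bound for the leaders of level exactly `L`. -/
lemma IsGAM.measure_leader_level_le [IsProbabilityMeasure μ] (hgam : IsGAM μ ℱ f s b t)
    (hf0 : f 0 = 0) (hf : ∀ i, 1 ≤ i → 0 < f i) (hp0 : 0 ≤ p) (hp : p < 1)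
    (hs : ∀ n ω, s n ω ≤ p) (hsum : Summable fun n : ℕ => 1 / f (n + 1))
    (hw : Summable (weight f p)) {x M : ℝ} (hx : 0 ≤ x) {L : ℕ} (hL : 1 ≤ L) :
    μ {ω | (∀ n, clock f p (theta f p) (fun i => s i ω) (fun i => b i ω) (fun i => t i ω) n ≤ M) ∧
        ∃ j, AtLevel (fun i => b i ω) (fun i => t i ω) j L ∧
          IsLeading (fun i => b i ω) (fun i => t i ω) j} ≤
      ENNReal.ofReal (Real.exp (x * M) * (Real.exp 1 * p / 4 * Phi f p x) ^ L) := by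
  have h := rates_theta hf hp hsum
  have hρ : 0 ≤ p / (1 - p) := div_nonneg hp0 (by linarith)
  refine (hgam.measure_le_of_eventually hf0 hf hp hs h (h.potential_nonneg hx hρ L)
    (stepBound_potential h (summable_discWeight hf hp hx hw) hx hρ L)
    (c := Real.exp (-(x * M))) (Real.exp_pos _) ?_).trans (ENNReal.ofReal_le_ofReal ?_)
  · filter_upwards [hgam.ae_lt_groupCount hf0 h] with ω hω
    rintro ⟨hclock, j, hj, hlead⟩ c' hc'
    obtain ⟨n₀, hn₀, hl⟩ := hj.exists_config (θ := theta f p) hω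
    have hlim := ((tendsto_tailProd (fun i =>
      ((config (theta f p) (fun i => b i ω) (fun i => t i ω) n₀).tilt j + if i = 1 then x else 0) /
        ((1 - p) * f i))).comp hlead).const_mul (Real.exp (-(x * M)))
    rw [mul_one] at hlim
    filter_upwards [hlim.eventually_const_lt hc', eventually_ge_atTop n₀] with n h1 hn
    obtain ⟨h2, h3, h4⟩ := config_stable hn hn₀
    have hC := config_good (n := n) h fun i _ => hω i
    have h5 := h.growthTail_le_potential (x := x) hx hρ hC h2
    rw [h3, hl, h4, config_size] at h5
    refine h1.le.trans (mul_le_mul ?_ h5 (tailProd_pos _ _).le (Real.exp_pos _).le)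
    rw [Real.exp_le_exp]
    nlinarith [hclock n]
  · rw [Real.exp_neg, div_inv_eq_mul, mul_comm, ← childTail_zero_eq hp]
    gcongr
    exact h.potential_init_le hx hρ hL

/-- The tail bound for a fixed time horizon `M`. -/
lemma IsGAM.measureReal_leadEvent_le [IsProbabilityMeasure μ] (hgam : IsGAM μ ℱ f s b t)
    (hf0 : f 0 = 0) (hf : ∀ i, 1 ≤ i → 0 < f i) (hp : p < 1)
    (hs : ∀ n ω, s n ω ≤ p) (hsum : Summable fun n : ℕ => 1 / f (n + 1))
    (hw : Summable (weight f p)) {M : ℝ} (hM : 0 < M) (n : ℕ) :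
    μ.real (leadEvent b t n) ≤ (Real.exp 1 * Phi f p (n / M)) ^ n +
      C₁ f * Real.exp (-(M * C₂ f p)) := by
  have hp0 : 0 ≤ p := by
    obtain ⟨ω⟩ := nonempty_of_isProbabilityMeasure μ
    exact (hgam.s_mem 0 ω).1.trans (hs 0 ω)
  have hx : 0 ≤ (n : ℝ) / M := by positivity
  have hPhi := Phi_pos hf hp hx hw
  have hC1 : 0 < C₁ f := Real.exp_pos _
  have hrest : 0 ≤ C₁ f * Real.exp (-(M * C₂ f p)) := by positivity
  -- Unless `n ≥ 1` and `exp 1 * Phi < 1`, the bound exceeds `1`.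
  by_cases htriv : 1 ≤ (Real.exp 1 * Phi f p (n / M)) ^ n
  · linarith [measureReal_le_one (μ := μ) (s := leadEvent b t n)]
  have hn : 1 ≤ n := by
    by_contra hn
    exact htriv (by simp [show n = 0 by omega])
  have hlt : Real.exp 1 * Phi f p (n / M) < 1 := by
    by_contra hcon
    exact htriv (one_le_pow₀ (not_lt.1 hcon))
  set x := (n : ℝ) / M with hxdef
  have hxM : x * M = n := by rw [hxdef]; field_simp
  set φ := Real.exp 1 * p / 4 * Phi f p x with hφ
  have hφ0 : 0 ≤ φ := by positivity
  have he := Real.exp_one_lt_d9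
  have hφ1 : φ ≤ 1 / 4 := by rw [hφ]; nlinarith
  have hφ2 : φ ≤ Real.exp 1 / 4 * Phi f p x := by
    rw [hφ]
    gcongr
    exact mul_le_of_le_one_right (Real.exp_pos _).le hp.le
  have hsubset : leadEvent b t n ⊆
      {ω | ∃ k, M < clock f p (theta f p) (fun i => s i ω) (fun i => b i ω) (fun i => t i ω) k} ∪
      ⋃ i : ℕ, {ω | (∀ k, clock f p (theta f p) (fun i => s i ω) (fun i => b i ω)
        (fun i => t i ω) k ≤ M) ∧ ∃ j, AtLevel (fun i => b i ω) (fun i => t i ω) j (n + i) ∧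
          IsLeading (fun i => b i ω) (fun i => t i ω) j} := by
    rintro ω ⟨j, ⟨k, hk, hlev⟩, hlead⟩
    by_cases hM' : ∃ k, M < clock f p (theta f p) (fun i => s i ω) (fun i => b i ω)
      (fun i => t i ω) k
    · exact Or.inl hM'
    · push Not at hM'
      obtain ⟨i, rfl⟩ := Nat.exists_eq_add_of_le hk
      exact Or.inr (Set.mem_iUnion.2 ⟨i, hM', j, hlev, hlead⟩)
  have hgeom := (hasSum_geometric_of_lt_one hφ0 (by linarith)).mul_left (Real.exp n * φ ^ n)
  have hlevels : Real.exp n * φ ^ n * (1 - φ)⁻¹ ≤ (Real.exp 1 * Phi f p x) ^ n := by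
    have h1 : (1 - φ)⁻¹ ≤ 4 / 3 := by
      rw [inv_le_comm₀ (by linarith) (by norm_num)]; linarith
    have h2 : (Real.exp 1 / 4) ^ n ≤ Real.exp 1 / 4 :=
      pow_le_of_le_one (by positivity) (by linarith) (by omega)
    calc Real.exp n * φ ^ n * (1 - φ)⁻¹
        ≤ Real.exp n * (Real.exp 1 / 4 * Phi f p x) ^ n * (4 / 3) := by
          have : 0 ≤ (1 - φ)⁻¹ := inv_nonneg.2 (by linarith)
          gcongr
      _ = (Real.exp 1 * Phi f p x) ^ n * ((Real.exp 1 / 4) ^ n * (4 / 3)) := by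
          rw [mul_pow, mul_pow, ← Real.exp_nat_mul, mul_one]; ring
      _ ≤ (Real.exp 1 * Phi f p x) ^ n * 1 := by
          gcongr; linarith
      _ = _ := mul_one _
  have hmain : μ (leadEvent b t n) ≤ ENNReal.ofReal
      ((Real.exp 1 * Phi f p x) ^ n + C₁ f * Real.exp (-(M * C₂ f p))) := by
    refine (measure_mono hsubset).trans ((measure_union_le _ _).trans ?_)
    rw [add_comm, ENNReal.ofReal_add (by positivity) hrest]
    refine add_le_add ((measure_iUnion_le _).trans ?_)
      (hgam.measure_clock_gt_le hf0 hf hp hs hsum M)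
    refine (ENNReal.tsum_le_tsum fun i =>
      hgam.measure_leader_level_le hf0 hf hp0 hp hs hsum hw hx (by omega)).trans ?_
    refine le_trans ?_ (ENNReal.ofReal_le_ofReal hlevels)
    rw [← hgeom.tsum_eq, ENNReal.ofReal_tsum_of_nonneg (fun i => by positivity) hgeom.summable]
    refine ENNReal.tsum_le_tsum fun i => ENNReal.ofReal_le_ofReal ?_
    rw [hxM, pow_add, mul_assoc]
  exact ENNReal.toReal_le_of_le_ofReal (by positivity) hmain

end Tail

end GAM

theorem theorem1p7 {Ω : Type*} [mΩ : MeasurableSpace Ω] (μ : Measure Ω) [IsProbabilityMeasure μ]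
    (ℱ : Filtration ℕ mΩ) (f : ℕ → ℝ) (s : ℕ → Ω → ℝ) (b : ℕ → Ω → Bool) (t : ℕ → Ω → ℕ) (p : ℝ)
    (hf0 : f 0 = 0) (hf : ∀ i, 1 ≤ i → 0 < f i)
    (hgam : GAM.IsGAM μ ℱ f s b t)
    (hp : p < 1) (hs : ∀ n ω, s n ω ≤ p)
    (hsum : Summable fun n : ℕ => 1 / f (n + 1))
    (hprod : Summable fun k : ℕ => GAM.weight f p (k + 1)) :
    0 < GAM.mConst f p ∧ 0 < GAM.C₁ f ∧ 0 < GAM.C₂ f p ∧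
    (∀ M : ℝ, 1 ≤ M → Tendsto (fun n : ℕ => GAM.rate f p n M) atTop atTop) ∧
    ∀ n : ℕ, μ.real (GAM.leadEvent b t n) ≤
      ⨅ q : Set.Ici (1 : ℝ) × Set.Ici (1 : ℝ),
        (GAM.mConst f p ^ n * Real.exp (-(GAM.rate f p n (q.2 : ℝ) * n))
          + ((q.1 : ℝ) ^ n)⁻¹
          + GAM.C₁ f * Real.exp (-((q.2 : ℝ) * GAM.C₂ f p))) := by
  have hw : Summable (GAM.weight f p) := (summable_nat_add_iff 1).1 hprod
  refine ⟨GAM.mConst_pos hf hp hw, Real.exp_pos _, ?_, fun M hM =>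
    GAM.tendsto_rate hf hp hw (by linarith), fun n => ?_⟩
  · have := GAM.minRate_pos hf hsum
    have h1p : 0 < 1 - p := by linarith
    unfold GAM.C₂
    positivity
  · have : Nonempty (Set.Ici (1 : ℝ)) := ⟨⟨1, Set.mem_Ici.2 le_rfl⟩⟩
    refine le_ciInf fun q => ?_
    have hr : (0 : ℝ) ≤ q.1 := zero_le_one.trans q.1.2
    have hM : (0 : ℝ) < q.2 := zero_lt_one.trans_le q.2.2
    rw [GAM.mConst_pow_mul_exp_rate hf hp hw hM n]
    have h1 := hgam.measureReal_leadEvent_le hf0 hf hp hs hsum hw hM n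
    have h2 : 0 ≤ ((q.1 : ℝ) ^ n)⁻¹ := by positivity
    linarith
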